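/- For $s\in\mathbb C$ put $\Gamma_{\mathbb R}(s)=\pi^{-s/2}\Gamma(s/2)$. For $n\ge 1$, $a=(a_1,\dots,a_n)\in\mathbb C^n$ write $|a|=a_1+\cdots+a_n$, and for $n\ge 2$ let $\widetilde a=(\widetilde a_1,\dots,\widetilde a_{n-1})$, $\widetilde a_j=a_{j+1}+\frac{a_1}{n-1}$. For $y_1,\dots,y_n>0$ let $\alpha[y_1,\dots,y_n]=\mathrm{diag}(y_1\cdots y_n,\,y_2\cdots y_n,\,\dots,\,y_n)\in GL_n(\mathbb R)$, and let $\widehat W_{n,a}(\alpha[y_1,\dots,y_n])$ be the class one Whittaker function of $GL_n(\mathbb R)$ divided by $\prod_{j=1}^{n-1}y_j^{j(n-j)/2}$, in the normalization given by $$\widehat W_{n,a}(\alpha[y_1,\dots,y_n])=y_n^{|a|}\,\widehat W_{n,a}(\alpha[y_1,\dots,y_{n-1},1]),$$ $\widehat W_{1,(a_1)}(\alpha[1])=1$, $\ \widehat W_{2,(a_1,a_2)}(\alpha[y_1,1])=2y_1^{(a_1+a_2)/2}K_{(a_1-a_2)/2}(2\pi y_1)$ (where $K$ is the $K$-Bessel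 function), and, for $n\ge 3$, $$\widehat W_{n,a}(\alpha[y_1,\dots,y_{n-1},1])=\int_{(\mathbb R_{>0})^{n-1}}\widehat W_{n-1,\widetilde a}\Bigl(\alpha\Bigl[y_2\sqrt{\tfrac{t_2}{t_1}},\dots,y_{n-1}\sqrt{\tfrac{t_{n-1}}{t_{n-2}}},1\Bigr]\Bigr)\biggl[\prod_{j=1}^{n-1}e^{-(\pi y_j)^2t_j-1/t_j}(\pi y_j)^{\frac{(n-j)a_1}{n-1}}t_j^{\frac{na_1}{2(n-1)}}\biggr](\pi t_{n-1})^{-|a|/2}\prod_{j=1}^{n-1}\frac{dt_j}{t_j}.$$ **Proposition.** Let $n\ge 2$, let $a\in\mathbb C^n$ satisfy $\mathrm{Re}(a_1)>\mathrm{Re}(a_j)$ for $2\le j\le n$, and let $y_1,\dots,y_n>0$. For $(x_1,\dots,x_{n-1})\in\mathbb R^{n-1}$ put $q_j=1+\sum_{p=j}^{n-1}x_p^2$ $(1\le j\le n-1)$ and $q_n=q_{n+1}=x_n=1$. Then the integral below converges absolutely, and $$\widehat W_{n,a}(\alpha[y_1,\dots,y_n])=\biggl[\prod_{j=2}^{n}\Gamma_{\mathbb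 R}(a_1-a_j+1)\biggr]y_n^{|a|}\biggl[\prod_{j=1}^{n-1}y_j^{-ja_1/(n-1)}\biggr]\int_{\mathbb R^{n-1}}\widehat W_{n-1,\widetilde a}\Bigl(\alpha\Bigl[y_1\tfrac{\sqrt{q_1q_3}}{q_2},\,y_2\tfrac{\sqrt{q_2q_4}}{q_3},\,\dots,\,y_{n-1}\tfrac{\sqrt{q_{n-1}q_{n+1}}}{q_n}\Bigr]\Bigr)\exp\biggl\{-2\pi i\sum_{j=1}^{n-1}\frac{x_jx_{j+1}}{q_{j+1}}\,y_j\biggr\}\,q_1^{-\frac{na_1}{2(n-1)}}\prod_{j=1}^{n-1}\frac{dx_j}{\sqrt{q_j}}.$$ -/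

import Mathlib

open MeasureTheory

noncomputable section

/-- The modified Bessel function of the second kind, `K_ν(z)`, for a real argument `z > 0`:
`K_ν(z) = (1/2) ∫_0^∞ exp (-(z/2) (t + 1/t)) t^ν dt/t`. -/
def besselK (ν : ℂ) (z : ℝ) : ℂ :=
  (1 / 2 : ℂ) *
    ∫ t in Set.Ioi (0 : ℝ), (Real.exp (-(z / 2) * (t + 1 / t)) : ℂ) * (t : ℂ) ^ ν * ((1 / t : ℝ) : ℂ)

/-- The parameter `ã = (ã_1, …, ã_{n-1})` attached to `a = (a_1, …, a_n)`, where `n = m + 1`: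
`ã_j = a_{j+1} + a_1 / (n - 1)`. Indices in Lean start from `0`. -/
def tildeParam {m : ℕ} (a : Fin (m + 1) → ℂ) : Fin m → ℂ :=
  fun j => a j.succ + a 0 / (m : ℂ)

/-- `glWhittakerHat n a y` is `Ŵ_{n,a}(α[y_1, …, y_n])`, the class one Whittaker function of
`GL_n(ℝ)` with the factor `y^ρ` removed, as a function of the coordinates `y_j > 0` of
`α[y_1, …, y_n] = diag (y_1 ⋯ y_n, y_2 ⋯ y_n, …, y_n)`, where `y_j` is `y ⟨j - 1, _⟩`.
* `n = 1`: `y_1 ^ a_1`;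
* `n = 2`: `y_2 ^ |a| * 2 y_1 ^ ((a_1 + a_2)/2) K_{(a_1 - a_2)/2}(2 π y_1)`;
* `n ≥ 3` (written `n = k + 3`): `y_n ^ |a|` times the integral over
  `t ∈ (ℝ_{>0})^{n-1}` against `∏ dt_j / t_j`.
The value for `n = 0` is a dummy. -/
def glWhittakerHat : (n : ℕ) → (Fin n → ℂ) → (Fin n → ℝ) → ℂ
  | 0, _, _ => 1
  | 1, a, y => (y 0 : ℂ) ^ a 0
  | 2, a, y =>
      (y 1 : ℂ) ^ (a 0 + a 1) *
        (2 * (y 0 : ℂ) ^ ((a 0 + a 1) / 2) *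
          besselK ((a 0 - a 1) / 2) (2 * Real.pi * y 0))
  | k + 3, a, y =>
      (y (Fin.last (k + 2)) : ℂ) ^ (∑ i, a i) *
        ∫ t in {t : Fin (k + 2) → ℝ | ∀ j, 0 < t j},
          glWhittakerHat (k + 2) (tildeParam a)
              (Fin.snoc (α := fun _ => ℝ)
                (fun i : Fin (k + 1) =>
                  y i.succ.castSucc * Real.sqrt (t i.succ / t i.castSucc)) 1) *
            (∏ j : Fin (k + 2),
              (Real.exp (-(Real.pi * y j.castSucc) ^ 2 * t j - 1 / t j) : ℂ) *
                ((Real.pi * y j.castSucc : ℝ) : ℂ) ^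
                  ((((k : ℂ) + 2) - (j : ℕ)) * a 0 / ((k : ℂ) + 2)) *
                (t j : ℂ) ^ (((k : ℂ) + 3) * a 0 / (2 * ((k : ℂ) + 2)))) *
            ((Real.pi * t (Fin.last (k + 1)) : ℝ) : ℂ) ^ (-(∑ i, a i) / 2) *
            ∏ j : Fin (k + 2), ((1 / t j : ℝ) : ℂ)

/-- With `x = (x_1, …, x_{n-1})`, `n = m + 1`, the number `qSum x j` is
`q_{j+1} = 1 + ∑_{p ≥ j+1} x_p ^ 2`. For `j ≥ m` the sum is empty, which gives
`q_n = q_{n+1} = 1`. -/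
def qSum {m : ℕ} (x : Fin m → ℝ) (j : ℕ) : ℝ :=
  1 + ∑ p ∈ Finset.univ.filter (fun p : Fin m => j ≤ (p : ℕ)), x p ^ 2

/-- `(x_1, …, x_{n-1}, x_n)` with `x_n = 1`. -/
def xExt {m : ℕ} (x : Fin m → ℝ) : Fin (m + 1) → ℝ :=
  Fin.snoc (α := fun _ => ℝ) x 1

/-- The integrand, with respect to `dx_1 ⋯ dx_{n-1}` (`n = m + 1`), of the recursion. -/
def glRecIntegrand {m : ℕ} (a : Fin (m + 1) → ℂ) (y : Fin (m + 1) → ℝ) (x : Fin m → ℝ) : ℂ :=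
  glWhittakerHat m (tildeParam a)
      (fun j => y j.castSucc *
        (Real.sqrt (qSum x (j : ℕ) * qSum x ((j : ℕ) + 2)) / qSum x ((j : ℕ) + 1))) *
    Complex.exp (-2 * Real.pi * Complex.I *
      ((∑ j : Fin m,
        xExt x j.castSucc * xExt x j.succ / qSum x ((j : ℕ) + 1) * y j.castSucc : ℝ) : ℂ)) *
    (qSum x 0 : ℂ) ^ (-(((m : ℂ) + 1) * a 0 / (2 * (m : ℂ)))) *
    ∏ j : Fin m, ((1 / Real.sqrt (qSum x (j : ℕ)) : ℝ) : ℂ)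

end

/-! ### One-variable exponential integrals -/

/-! In logarithmic coordinates the Whittaker function is a Toda eigenfunction `todaPsi`, built one
rank at a time by an integral operator Λ(a) with kernel `todaKer` (a Givental-type recursion). The
defining recursion of `glWhittakerHat` is Λ(a₁) after a substitution, up to twists and translations
(`glWhittakerHat_eq_todaPsi`).

The new recursion comes from the Baxter operator Q(s), with kernel `baxterKer`. It satisfies Q(s)
Λ(a) = Γ_ℝ(s - a) Λ(a) Q(s), where the two Q's act in consecutive ranks
(`integral_baxterKer_mul_todaKer`). By induction on the rank, Q(s) multiplies the eigenfunction with
parameters b by ∏ Γ_ℝ(s - b_j) (`integral_baxterKer_mul_todaPsi`). Taking s = a₁ + 1 produces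
exactly the Gamma factors of the statement.

It remains to read this eigenvalue equation at the point `logShift L x`, multiply by the oscillating
weight `jacquetWeight`, and integrate over x. The kernel times the weight is an elementary
exponential times `gaussChain` (`baxterKer_logShift`). The integral of the chain over x₁, x₂, … in
turn is a sequence of Gaussian Fourier transforms, and the result is the Toda kernel Λ(a₁)
(`gaussChain_integral`). Exchanging the integrals therefore gives the eigenfunction of the next
rank.

Every exchange of integrals rests on one class of majorants, products of `expBound`, preserved by
the absolute values of both kernels. -/

theorem setIntegral_Ioi_eq_integral_comp_exp {E : Type*} [NormedAddCommGroup E] [NormedSpace ℝ E]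
    (g : ℝ → E) :
    ∫ t in Set.Ioi (0 : ℝ), g t = ∫ z : ℝ, Real.exp z • g (Real.exp z) := by
  have h := integral_image_eq_integral_abs_deriv_smul (s := Set.univ) (f := Real.exp)
    (f' := Real.exp) MeasurableSet.univ (fun x _ => (Real.hasDerivAt_exp x).hasDerivWithinAt)
    Real.exp_injective.injOn g
  simpa [Set.image_univ, Real.range_exp] using h

theorem cexp_mul_sub_exp_eq (s : ℂ) (z : ℝ) :
    Complex.exp (s * z - Real.exp z) =
      Real.exp z • ((Real.exp (-Real.exp z) : ℂ) * (Real.exp z : ℂ) ^ (s - 1)) := by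
  rw [Complex.cpow_def_of_ne_zero (by exact_mod_cast (Real.exp_pos z).ne'),
    ← Complex.ofReal_log (Real.exp_pos z).le, Real.log_exp, Complex.real_smul]
  push_cast
  rw [← Complex.exp_add, ← Complex.exp_add]
  congr 1
  ring

theorem integrable_cexp_mul_sub_exp {s : ℂ} (hs : 0 < s.re) :
    Integrable (fun z : ℝ => Complex.exp (s * z - Real.exp z)) := by
  have h := (integrableOn_image_iff_integrableOn_abs_deriv_smul (s := Set.univ) (f := Real.exp)
    (f' := Real.exp) MeasurableSet.univ (fun x _ => (Real.hasDerivAt_exp x).hasDerivWithinAt)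
    Real.exp_injective.injOn
    (fun x => ((-x).exp : ℂ) * (x : ℂ) ^ (s - 1))).1
    (by simpa [Set.image_univ, Real.range_exp] using Complex.GammaIntegral_convergent hs)
  simp_rw [cexp_mul_sub_exp_eq]
  simpa using h

theorem integral_cexp_mul_sub_exp {s : ℂ} (hs : 0 < s.re) :
    ∫ z : ℝ, Complex.exp (s * z - Real.exp z) = Complex.Gamma s := by
  rw [Complex.Gamma_eq_integral hs, Complex.GammaIntegral, setIntegral_Ioi_eq_integral_comp_exp]
  simp_rw [cexp_mul_sub_exp_eq]

/-- The one-variable kernel `exp (ν z - π (A e^{-z} + B e^z))`. -/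
noncomputable def besselKer (ν : ℂ) (A B z : ℝ) : ℂ :=
  Complex.exp (ν * z - ((Real.pi * (A * Real.exp (-z) + B * Real.exp z) : ℝ) : ℂ))

/-- The reflection z ↦ log A - log B - z interchanges the two exponential terms of the kernel. -/
theorem integral_besselKer_neg (ν : ℂ) {A B : ℝ} (hA : 0 < A) (hB : 0 < B) :
    ∫ z, besselKer (-ν) A B z =
      Complex.exp (-ν * ((Real.log A - Real.log B : ℝ) : ℂ)) * ∫ z, besselKer ν A B z := by
  rw [← integral_const_mul, ← integral_sub_left_eq_self _ volume (Real.log A - Real.log B)]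
  congr 1
  ext z
  rw [besselKer, besselKer, ← Complex.exp_add]
  congr 1
  have h1 : A * Real.exp (-(Real.log A - Real.log B - z)) = B * Real.exp z := by
    rw [show -(Real.log A - Real.log B - z) = Real.log B - Real.log A + z by ring, Real.exp_add,
      Real.exp_sub, Real.exp_log hA, Real.exp_log hB]
    field_simp
  have h2 : B * Real.exp (Real.log A - Real.log B - z) = A * Real.exp (-z) := by
    rw [sub_eq_add_neg _ z, Real.exp_add, Real.exp_sub, Real.exp_log hA, Real.exp_log hB]
    field_simp
  rw [h1, h2]
  push_cast
  ring

/-- With one exponential missing, the substitution z ↦ log (πA) - z leaves Euler's integral. This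
degenerate Bessel integral is the source of every Gamma factor. -/
theorem integral_besselKer_zero_right {ν : ℂ} (hν : 0 < ν.re) {A : ℝ} (hA : 0 < A) :
    ∫ z, besselKer (-ν) A 0 z = Complex.Gammaℝ (2 * ν) * Complex.exp (-ν * (Real.log A : ℝ)) := by
  rw [← integral_sub_left_eq_self _ volume (Real.log Real.pi + Real.log A)]
  have : ∀ z : ℝ, besselKer (-ν) A 0 (Real.log Real.pi + Real.log A - z) =
      Complex.exp (-ν * ((Real.log Real.pi + Real.log A : ℝ) : ℂ)) *
        Complex.exp (ν * z - Real.exp z) := by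
    intro z
    rw [besselKer, ← Complex.exp_add]
    congr 1
    have h1 : Real.pi * (A * Real.exp (-(Real.log Real.pi + Real.log A - z)) +
        0 * Real.exp (Real.log Real.pi + Real.log A - z)) = Real.exp z := by
      rw [show -(Real.log Real.pi + Real.log A - z) = z - (Real.log Real.pi + Real.log A) by ring,
        Real.exp_sub, Real.exp_add, Real.exp_log hA, Real.exp_log Real.pi_pos]
      have := Real.pi_pos
      field_simp
      ring
    rw [h1]
    push_cast
    ring
  simp_rw [this]
  rw [integral_const_mul, integral_cexp_mul_sub_exp hν, Complex.Gammaℝ_def,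
    Complex.cpow_def_of_ne_zero (by exact_mod_cast Real.pi_pos.ne'),
    ← Complex.ofReal_log Real.pi_pos.le]
  push_cast
  rw [mul_add, Complex.exp_add]
  rw [show (2 * ν / 2) = ν by ring, show (Real.log Real.pi : ℂ) * (-(2 * ν) / 2) =
    -ν * Real.log Real.pi by ring]
  ring

/-! ### Exponential majorants for the kernels. -/

theorem integrable_exp_mul_sub_exp {c : ℝ} (hc : 0 < c) :
    Integrable (fun z : ℝ => Real.exp (c * z - Real.pi * Real.exp z)) := by
  have h := (integrable_cexp_mul_sub_exp (s := (c : ℂ)) (by simpa using hc)).norm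
  have h2 : Integrable (fun z : ℝ => Real.exp (c * z - Real.exp z)) := by
    refine h.congr (Filter.Eventually.of_forall fun z => ?_)
    simp [Complex.norm_exp, Complex.exp_ofReal_re]
  refine h2.mono' (by fun_prop) (Filter.Eventually.of_forall fun z => ?_)
  rw [Real.norm_eq_abs, abs_of_pos (Real.exp_pos _)]
  gcongr
  nlinarith [Real.exp_pos z, Real.pi_gt_three]

/-- A two-sided exponential majorant. -/
noncomputable def expBound (β N z : ℝ) : ℝ := Real.exp (β * z) + Real.exp (-N * z)

theorem expBound_pos (β N z : ℝ) : 0 < expBound β N z := by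
  unfold expBound; positivity

theorem exp_mul_le_expBound {β N c : ℝ} (h1 : -N ≤ c) (h2 : c ≤ β) (z : ℝ) :
    Real.exp (c * z) ≤ expBound β N z := by
  rcases le_total 0 z with h | h
  · exact (Real.exp_le_exp.2 (by nlinarith)).trans (le_add_of_nonneg_right (Real.exp_pos _).le)
  · exact (Real.exp_le_exp.2 (by nlinarith)).trans (le_add_of_nonneg_left (Real.exp_pos _).le)

/-- Majorant of one factor of the Baxter kernel. -/
noncomputable def baxterFactor (σ x z : ℝ) : ℝ := Real.exp (σ * (x - z) - Real.pi * Real.exp (x - z))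

/-- The factor depends only on x - z, so exponentials are eigenfunctions of this convolution. Decay
as z → +∞ comes only from σ, hence the condition c < σ. -/
theorem integrable_baxterFactor_mul_exp {σ c : ℝ} (h : c < σ) (x : ℝ) :
    Integrable (fun z => baxterFactor σ x z * Real.exp (c * z)) ∧
    ∫ z, baxterFactor σ x z * Real.exp (c * z) =
      (∫ z : ℝ, Real.exp ((σ - c) * z - Real.pi * Real.exp z)) * Real.exp (c * x) := by
  have hf : (fun z => baxterFactor σ x z * Real.exp (c * z)) =
      fun z => (fun w : ℝ => Real.exp ((σ - c) * w - Real.pi * Real.exp w) * Real.exp (c * x))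
        (x - z) := by
    ext z
    simp only [baxterFactor]
    rw [← Real.exp_add, ← Real.exp_add]
    ring_nf
  rw [hf]
  refine ⟨((integrable_exp_mul_sub_exp (sub_pos.2 h)).mul_const _).comp_sub_left x, ?_⟩
  rw [integral_sub_left_eq_self (fun w : ℝ =>
    Real.exp ((σ - c) * w - Real.pi * Real.exp w) * Real.exp (c * x)) volume x,
    integral_mul_const]

theorem integrable_baxterFactor_mul_expBound {σ β N : ℝ} (h1 : β < σ) (h2 : -N < σ) (x : ℝ) :
    Integrable (fun z => baxterFactor σ x z * expBound β N z) := by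
  simp only [expBound, mul_add]
  exact (integrable_baxterFactor_mul_exp h1 x).1.add (integrable_baxterFactor_mul_exp h2 x).1

theorem integral_baxterFactor_mul_expBound_le {σ β N : ℝ} (h1 : β < σ) (h2 : -N < σ) :
    ∃ C, 0 ≤ C ∧ ∀ x, ∫ z, baxterFactor σ x z * expBound β N z ≤ C * expBound β N x := by
  refine ⟨(∫ z : ℝ, Real.exp ((σ - β) * z - Real.pi * Real.exp z)) +
    ∫ z : ℝ, Real.exp ((σ - -N) * z - Real.pi * Real.exp z), ?_, fun x => ?_⟩
  · exact add_nonneg (integral_nonneg fun _ => (Real.exp_pos _).le)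
      (integral_nonneg fun _ => (Real.exp_pos _).le)
  · have e1 := integrable_baxterFactor_mul_exp h1 x
    have e2 := integrable_baxterFactor_mul_exp h2 x
    simp only [expBound, mul_add]
    rw [integral_add e1.1 e2.1, e1.2, e2.2]
    have p1 : 0 ≤ ∫ z : ℝ, Real.exp ((σ - β) * z - Real.pi * Real.exp z) :=
      integral_nonneg fun _ => (Real.exp_pos _).le
    have p2 : 0 ≤ ∫ z : ℝ, Real.exp ((σ - -N) * z - Real.pi * Real.exp z) :=
      integral_nonneg fun _ => (Real.exp_pos _).le
    nlinarith [Real.exp_pos (β * x), Real.exp_pos (-N * x),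
      mul_nonneg p1 (Real.exp_pos (-N * x)).le, mul_nonneg p2 (Real.exp_pos (β * x)).le]

/-- Majorant of one factor of the Toda kernel. -/
noncomputable def todaFactor (σ x y u : ℝ) : ℝ :=
  Real.exp (σ * (x - u) - Real.pi * (Real.exp (x - u) + Real.exp (u - y)))

/-- The term exp (x - u) is dropped; what remains is integrable in u when σ < c. For c < σ the other
term is dropped instead, by `todaFactor_le_baxterFactor`. -/
theorem todaFactor_mul_exp_le (σ c x y u : ℝ) :
    todaFactor σ x y u * Real.exp (c * u) ≤ Real.exp (σ * x) * Real.exp ((c - σ) * y) *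
      Real.exp ((c - σ) * (u - y) - Real.pi * Real.exp (u - y)) := by
  rw [todaFactor, ← Real.exp_add, ← Real.exp_add, ← Real.exp_add]
  refine Real.exp_le_exp.2 ?_
  nlinarith [mul_pos Real.pi_pos (Real.exp_pos (x - u))]

theorem todaFactor_le_baxterFactor (σ x y u : ℝ) :
    todaFactor σ x y u ≤ baxterFactor σ x u := by
  rw [todaFactor, baxterFactor]
  refine Real.exp_le_exp.2 ?_
  nlinarith [mul_pos Real.pi_pos (Real.exp_pos (u - y))]

theorem todaFactor_pos (σ x y u : ℝ) : 0 < todaFactor σ x y u := Real.exp_pos _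

theorem baxterFactor_pos (σ x u : ℝ) : 0 < baxterFactor σ x u := Real.exp_pos _

theorem integrable_todaFactor_mul_exp_of_lt {σ c : ℝ} (h : σ < c) (x y : ℝ) :
    Integrable (fun u => todaFactor σ x y u * Real.exp (c * u)) ∧
    ∫ u, todaFactor σ x y u * Real.exp (c * u) ≤
      (∫ z : ℝ, Real.exp ((c - σ) * z - Real.pi * Real.exp z)) *
        (Real.exp (σ * x) * Real.exp ((c - σ) * y)) := by
  have hi := ((integrable_exp_mul_sub_exp (sub_pos.2 h)).comp_sub_right y).const_mul
    (Real.exp (σ * x) * Real.exp ((c - σ) * y))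
  have hI : Integrable (fun u => todaFactor σ x y u * Real.exp (c * u)) := by
    refine hi.mono' (by unfold todaFactor; fun_prop) (Filter.Eventually.of_forall fun u => ?_)
    rw [Real.norm_eq_abs, abs_of_pos (mul_pos (todaFactor_pos _ _ _ _) (Real.exp_pos _))]
    exact todaFactor_mul_exp_le σ c x y u
  refine ⟨hI, (integral_mono hI hi fun u => todaFactor_mul_exp_le σ c x y u).trans_eq ?_⟩
  rw [integral_const_mul, integral_sub_right_eq_self
    (fun z : ℝ => Real.exp ((c - σ) * z - Real.pi * Real.exp z)), mul_comm]

theorem integrable_todaFactor_mul_exp_of_gt {σ c : ℝ} (h : c < σ) (x y : ℝ) :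
    Integrable (fun u => todaFactor σ x y u * Real.exp (c * u)) ∧
    ∫ u, todaFactor σ x y u * Real.exp (c * u) ≤
      (∫ z : ℝ, Real.exp ((σ - c) * z - Real.pi * Real.exp z)) * Real.exp (c * x) := by
  have hi := integrable_baxterFactor_mul_exp h x
  have hle : ∀ u, todaFactor σ x y u * Real.exp (c * u) ≤
      baxterFactor σ x u * Real.exp (c * u) := fun u =>
    mul_le_mul_of_nonneg_right (todaFactor_le_baxterFactor σ x y u) (Real.exp_pos _).le
  have hI : Integrable (fun u => todaFactor σ x y u * Real.exp (c * u)) := by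
    refine hi.1.mono' (by unfold todaFactor; fun_prop) (Filter.Eventually.of_forall fun u => ?_)
    rw [Real.norm_eq_abs, abs_of_pos (mul_pos (todaFactor_pos _ _ _ _) (Real.exp_pos _))]
    exact hle u
  exact ⟨hI, (integral_mono hI hi.1 hle).trans_eq hi.2⟩

theorem integrable_todaFactor_mul_expBound {σ β N : ℝ} (h1 : σ < β) (h2 : -N < σ) (x y : ℝ) :
    Integrable (fun u => todaFactor σ x y u * expBound β N u) := by
  simp only [expBound, mul_add]
  exact (integrable_todaFactor_mul_exp_of_lt h1 x y).1.add
    (integrable_todaFactor_mul_exp_of_gt h2 x y).1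

/-- The bound separates x from y on purpose. In the product over all coordinates, an interior
coordinate is the x of one factor and the y of its neighbour, and the two contributions are
recombined by `exp_mul_one_add_mul_one_add_le`. -/
theorem integral_todaFactor_mul_expBound_le {σ β N : ℝ} (h1 : σ < β) (h2 : -N < σ) :
    ∃ C, 0 ≤ C ∧ ∀ x y, ∫ u, todaFactor σ x y u * expBound β N u ≤
      C * (Real.exp (σ * x) * (1 + Real.exp (-(N + σ) * x)) * (1 + Real.exp ((β - σ) * y))) := by
  set C1 := ∫ z : ℝ, Real.exp ((β - σ) * z - Real.pi * Real.exp z) with hC1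
  set C2 := ∫ z : ℝ, Real.exp ((σ - -N) * z - Real.pi * Real.exp z) with hC2
  have p1 : 0 ≤ C1 := integral_nonneg fun _ => (Real.exp_pos _).le
  have p2 : 0 ≤ C2 := integral_nonneg fun _ => (Real.exp_pos _).le
  refine ⟨C1 + C2, add_nonneg p1 p2, fun x y => ?_⟩
  have e1 := integrable_todaFactor_mul_exp_of_lt h1 x y
  have e2 := integrable_todaFactor_mul_exp_of_gt h2 x y
  have : ∀ u, todaFactor σ x y u * expBound β N u = todaFactor σ x y u * Real.exp (β * u) +
    todaFactor σ x y u * Real.exp (-N * u) := fun u => by rw [expBound, mul_add]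
  simp_rw [this]
  rw [integral_add e1.1 e2.1]
  refine (add_le_add e1.2 e2.2).trans ?_
  rw [← hC1, ← hC2]
  have hx : Real.exp (-N * x) = Real.exp (σ * x) * Real.exp (-(N + σ) * x) := by
    rw [← Real.exp_add]; ring_nf
  rw [hx]
  generalize hX : Real.exp (σ * x) = X
  generalize hY : Real.exp (-(N + σ) * x) = Y
  generalize hZ : Real.exp ((β - σ) * y) = Z
  have hX' : 0 ≤ X := hX ▸ (Real.exp_pos _).le
  have hY' : 0 ≤ Y := hY ▸ (Real.exp_pos _).le
  have hZ' : 0 ≤ Z := hZ ▸ (Real.exp_pos _).le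
  have t1 : X * Z ≤ X * (1 + Y) * (1 + Z) := by
    have : 0 ≤ X * (1 + Y + Y * Z) := by positivity
    nlinarith
  have t2 : X * Y ≤ X * (1 + Y) * (1 + Z) := by
    have : 0 ≤ X * (1 + Z + Y * Z) := by positivity
    nlinarith
  nlinarith [mul_le_mul_of_nonneg_left t1 p1, mul_le_mul_of_nonneg_left t2 p2]

theorem exp_mul_one_add_mul_one_add_le {σ β N : ℝ} (h1 : σ < β) (h2 : -N < σ) (x : ℝ) :
    Real.exp (σ * x) * (1 + Real.exp (-(N + σ) * x)) * (1 + Real.exp ((β - σ) * x)) ≤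
      3 * expBound β N x := by
  have e1 := exp_mul_le_expBound h2.le h1.le x
  have e2 := exp_mul_le_expBound (β := β) (N := N) (c := β - N - σ) (by linarith) (by linarith) x
  have : Real.exp (σ * x) * (1 + Real.exp (-(N + σ) * x)) * (1 + Real.exp ((β - σ) * x)) =
      Real.exp (σ * x) + Real.exp ((β - N - σ) * x) + expBound β N x := by
    rw [expBound, show β * x = σ * x + (β - σ) * x by ring,
      show -N * x = σ * x + -(N + σ) * x by ring,
      show (β - N - σ) * x = σ * x + -(N + σ) * x + (β - σ) * x by ring, Real.exp_add,
      Real.exp_add, Real.exp_add]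
    ring
  linarith

/-! ### The Toda and Baxter kernels and their commutation -/

/-- The kernel of the recursion operator raising `GL_n` Toda eigenfunctions to `GL_{n+1}`. -/
noncomputable def todaKer {n : ℕ} (a : ℂ) (x : Fin (n + 1) → ℝ) (u : Fin n → ℝ) : ℂ :=
  Complex.exp (a / 2 * ((∑ j, x j : ℝ) : ℂ)) *
    ∏ j, besselKer (-(a / 2)) (Real.exp (x j.castSucc)) (Real.exp (-x j.succ)) (u j)

/-- The kernel of the Baxter operator on `GL_m`. -/
noncomputable def baxterKer {m : ℕ} (s : ℂ) (x z : Fin m → ℝ) : ℂ :=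
  Complex.exp (s / 2 * ((∑ j, x j : ℝ) : ℂ)) *
    ∏ j : Fin m, besselKer (-(s / 2)) (Real.exp (x j))
      ((Fin.snoc (α := fun _ => ℝ) (fun i => Real.exp (-x i)) 0 : Fin (m + 1) → ℝ) j.succ) (z j)

theorem prod_besselKer {ι : Type*} [Fintype ι] (ν : ℂ) (A B z : ι → ℝ) :
    ∏ j, besselKer ν (A j) (B j) (z j) =
      Complex.exp (ν * ((∑ j, z j : ℝ) : ℂ) -
        ((Real.pi * (∑ j, A j * Real.exp (-z j) + ∑ j, B j * Real.exp (z j)) : ℝ) : ℂ)) := by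
  simp only [besselKer]
  rw [← Complex.exp_sum, Finset.sum_sub_distrib, ← Finset.sum_add_distrib, Finset.mul_sum]
  push_cast
  rw [Finset.mul_sum]

/-- Shift of index that regroups the coupling of neighbouring coordinates by the other variable. -/
theorem sum_snoc_succ_eq {m : ℕ} (x z : Fin m → ℝ) :
    ∑ j : Fin m, (Fin.snoc (α := fun _ => ℝ) x 0 : Fin (m + 1) → ℝ) j.succ * z j =
      ∑ j : Fin m, (Fin.cons (α := fun _ => ℝ) 0 z : Fin (m + 1) → ℝ) j.castSucc * x j := by
  cases m with
  | zero => simp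
  | succ k =>
    rw [Fin.sum_univ_castSucc, Fin.sum_univ_succ (f := fun j : Fin (k + 1) =>
      (Fin.cons (α := fun _ => ℝ) 0 z : Fin (k + 2) → ℝ) j.castSucc * x j)]
    simp only [Fin.succ_last, Fin.snoc_last, Fin.castSucc_zero, Fin.cons_zero, zero_mul, add_zero,
      zero_add, ← Fin.succ_castSucc, Fin.cons_succ]
    simp only [Fin.succ_castSucc, Fin.snoc_castSucc]
    exact Finset.sum_congr rfl fun i _ => mul_comm _ _

theorem todaKer_eq {n : ℕ} (a : ℂ) (x : Fin (n + 1) → ℝ) (u : Fin n → ℝ) :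
    todaKer a x u = Complex.exp (a / 2 * ((∑ j, x j - ∑ j, u j : ℝ) : ℂ) -
      ((Real.pi * (∑ j : Fin n, Real.exp (x j.castSucc) * Real.exp (-u j) +
        ∑ j : Fin n, Real.exp (-x j.succ) * Real.exp (u j)) : ℝ) : ℂ)) := by
  rw [todaKer, prod_besselKer (-(a / 2)) (fun j : Fin n => Real.exp (x j.castSucc))
    (fun j : Fin n => Real.exp (-x j.succ)), ← Complex.exp_add]
  congr 1
  rw [Complex.ofReal_sub]
  ring

theorem baxterKer_eq {m : ℕ} (s : ℂ) (x z : Fin m → ℝ) :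
    baxterKer s x z = Complex.exp (s / 2 * ((∑ j, x j - ∑ j, z j : ℝ) : ℂ) -
      ((Real.pi * (∑ j : Fin m, Real.exp (x j) * Real.exp (-z j) +
        ∑ j : Fin m, (Fin.snoc (α := fun _ => ℝ) (fun i => Real.exp (-x i)) 0 : Fin (m + 1) → ℝ)
          j.succ * Real.exp (z j)) : ℝ) : ℂ)) := by
  rw [baxterKer, prod_besselKer (-(s / 2)) (fun j => Real.exp (x j))
    (fun j => (Fin.snoc (α := fun _ => ℝ) (fun i => Real.exp (-x i)) 0 : Fin (m + 1) → ℝ) j.succ),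
    ← Complex.exp_add]
  congr 1
  rw [Complex.ofReal_sub]
  ring

/-- For fixed x and v the dependence on the middle variable z decouples into one-variable kernels.
The last of them has second coefficient 0, since both `Fin.snoc` terms vanish there. -/
theorem baxterKer_mul_todaKer {k : ℕ} (s a : ℂ) (x z : Fin (k + 1) → ℝ) (v : Fin k → ℝ) :
    baxterKer s x z * todaKer a z v =
      Complex.exp (s / 2 * ((∑ j, x j : ℝ) : ℂ) - a / 2 * ((∑ j, v j : ℝ) : ℂ)) *
        ∏ j, besselKer (-((s - a) / 2))
          (Real.exp (x j) +
            (Fin.cons (α := fun _ => ℝ) 0 (fun i => Real.exp (v i)) : Fin (k + 1) → ℝ) j)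
          ((Fin.snoc (α := fun _ => ℝ) (fun i => Real.exp (-x i)) 0 : Fin (k + 2) → ℝ) j.succ +
            (Fin.snoc (α := fun _ => ℝ) (fun i => Real.exp (-v i)) 0 : Fin (k + 1) → ℝ) j)
          (z j) := by
  rw [baxterKer_eq, todaKer_eq, prod_besselKer (-((s - a) / 2)) (fun j => Real.exp (x j) +
            (Fin.cons (α := fun _ => ℝ) 0 (fun i => Real.exp (v i)) : Fin (k + 1) → ℝ) j)
          (fun j => (Fin.snoc (α := fun _ => ℝ) (fun i => Real.exp (-x i)) 0 :
            Fin (k + 2) → ℝ) j.succ +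
            (Fin.snoc (α := fun _ => ℝ) (fun i => Real.exp (-v i)) 0 : Fin (k + 1) → ℝ) j),
    ← Complex.exp_add, ← Complex.exp_add]
  congr 1
  simp only [add_mul, Finset.sum_add_distrib]
  have h1 : ∑ j, (Fin.cons (α := fun _ => ℝ) 0 (fun i => Real.exp (v i)) : Fin (k + 1) → ℝ) j *
      Real.exp (-z j) = ∑ j : Fin k, Real.exp (-z j.succ) * Real.exp (v j) := by
    rw [Fin.sum_univ_succ]
    simp [mul_comm]
  have h2 : ∑ j, (Fin.snoc (α := fun _ => ℝ) (fun i => Real.exp (-v i)) 0 : Fin (k + 1) → ℝ) j *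
      Real.exp (z j) = ∑ j : Fin k, Real.exp (z j.castSucc) * Real.exp (-v j) := by
    rw [Fin.sum_univ_castSucc]
    simp [mul_comm]
  rw [h1, h2]
  push_cast
  ring

/-- In the opposite order the decoupled factors have the same coefficients as in
`baxterKer_mul_todaKer`, with the sign of the exponent reversed and the last factor absent. -/
theorem todaKer_mul_baxterKer {k : ℕ} (s a : ℂ) (x : Fin (k + 1) → ℝ) (u v : Fin k → ℝ) :
    todaKer a x u * baxterKer s u v =
      Complex.exp (a / 2 * ((∑ j, x j : ℝ) : ℂ) - s / 2 * ((∑ j, v j : ℝ) : ℂ)) *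
        ∏ j : Fin k, besselKer ((s - a) / 2)
          (Real.exp (x j.castSucc) +
            (Fin.cons (α := fun _ => ℝ) 0 (fun i => Real.exp (v i)) : Fin (k + 1) → ℝ) j.castSucc)
          (Real.exp (-x j.succ) + Real.exp (-v j)) (u j) := by
  rw [baxterKer_eq, todaKer_eq, prod_besselKer ((s - a) / 2) (fun j : Fin k =>
    Real.exp (x j.castSucc) +
      (Fin.cons (α := fun _ => ℝ) 0 (fun i => Real.exp (v i)) : Fin (k + 1) → ℝ) j.castSucc)
    (fun j => Real.exp (-x j.succ) + Real.exp (-v j)), sum_snoc_succ_eq,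
    ← Complex.exp_add, ← Complex.exp_add]
  congr 1
  simp only [add_mul, Finset.sum_add_distrib]
  have h1 : ∑ j : Fin k, Real.exp (-v j) * Real.exp (u j) =
      ∑ j : Fin k, Real.exp (u j) * Real.exp (-v j) :=
    Finset.sum_congr rfl fun i _ => mul_comm _ _
  rw [h1]
  push_cast
  ring

/-- The two orders of composition are compared coordinate by coordinate: reflection matches the
first k factors, the extra one gives the Gamma factor, and the powers of A and B left over telescope
into the change of exponential prefactor. -/
theorem integral_baxterKer_mul_todaKer {k : ℕ} {s a : ℂ} (h : a.re < s.re)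
    (x : Fin (k + 1) → ℝ) (v : Fin k → ℝ) :
    ∫ z, baxterKer s x z * todaKer a z v =
      Complex.Gammaℝ (s - a) * ∫ u, todaKer a x u * baxterKer s u v := by
  simp_rw [baxterKer_mul_todaKer, todaKer_mul_baxterKer]
  rw [integral_const_mul, integral_const_mul]
  set A : Fin (k + 1) → ℝ := fun j => Real.exp (x j) +
    (Fin.cons (α := fun _ => ℝ) 0 (fun i => Real.exp (v i)) : Fin (k + 1) → ℝ) j with hA
  have hApos : ∀ j, 0 < A j := by
    intro j
    refine add_pos_of_pos_of_nonneg (Real.exp_pos _) ?_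
    refine Fin.cases ?_ (fun i => ?_) j
    · simp
    · simpa using (Real.exp_pos _).le
  set B : Fin k → ℝ := fun j => Real.exp (-x j.succ) + Real.exp (-v j) with hB
  have hBpos : ∀ j, 0 < B j := fun j => by positivity
  have hν : 0 < ((s - a) / 2).re := by
    simpa using h
  rw [integral_fintype_prod_volume_eq_prod (fun j => besselKer (-((s - a) / 2)) (A j)
      ((Fin.snoc (α := fun _ => ℝ) (fun i => Real.exp (-x i)) 0 : Fin (k + 2) → ℝ) j.succ +
        (Fin.snoc (α := fun _ => ℝ) (fun i => Real.exp (-v i)) 0 : Fin (k + 1) → ℝ) j)),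
    integral_fintype_prod_volume_eq_prod (fun j : Fin k => besselKer ((s - a) / 2)
      (A j.castSucc) (B j)), Fin.prod_univ_castSucc]
  have e1 : ∀ j : Fin k, ∫ z, besselKer (-((s - a) / 2)) (A j.castSucc)
      ((Fin.snoc (α := fun _ => ℝ) (fun i => Real.exp (-x i)) 0 : Fin (k + 2) → ℝ)
          j.castSucc.succ +
        (Fin.snoc (α := fun _ => ℝ) (fun i => Real.exp (-v i)) 0 : Fin (k + 1) → ℝ) j.castSucc) z =
      Complex.exp (-((s - a) / 2) * ((Real.log (A j.castSucc) - Real.log (B j) : ℝ) : ℂ)) *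
        ∫ z, besselKer ((s - a) / 2) (A j.castSucc) (B j) z := by
    intro j
    rw [← integral_besselKer_neg _ (hApos _) (hBpos _), Fin.succ_castSucc, Fin.snoc_castSucc,
      Fin.snoc_castSucc]
  have e2 : ∫ z, besselKer (-((s - a) / 2)) (A (Fin.last k))
      ((Fin.snoc (α := fun _ => ℝ) (fun i => Real.exp (-x i)) 0 : Fin (k + 2) → ℝ)
          (Fin.last k).succ +
        (Fin.snoc (α := fun _ => ℝ) (fun i => Real.exp (-v i)) 0 : Fin (k + 1) → ℝ)
          (Fin.last k)) z = Complex.Gammaℝ (s - a) *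
      Complex.exp (-((s - a) / 2) * (Real.log (A (Fin.last k)) : ℝ)) := by
    rw [Fin.succ_last, Fin.snoc_last, Fin.snoc_last, add_zero,
      integral_besselKer_zero_right hν (hApos _)]
    congr 2
    ring
  -- Telescoping: A_{j+1} = B_j exp (x_{j+1} + v_j) and A_0 = exp x_0.
  have hlog : ∑ j : Fin k, (Real.log (A j.castSucc) - Real.log (B j)) +
      Real.log (A (Fin.last k)) = ∑ j, x j + ∑ j, v j := by
    have hlB : ∀ j : Fin k, Real.log (B j) = Real.log (A j.succ) - x j.succ - v j := by
      intro j
      have : A j.succ = B j * Real.exp (x j.succ + v j) := by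
        simp only [hA, hB, Fin.cons_succ, add_mul]
        rw [← Real.exp_add, ← Real.exp_add, add_comm]
        congr 2 <;> ring
      rw [this, Real.log_mul (hBpos j).ne' (Real.exp_pos _).ne', Real.log_exp]
      ring
    have h0 : Real.log (A 0) = x 0 := by simp [hA]
    have e := Fin.sum_univ_castSucc fun j => Real.log (A j)
    rw [Fin.sum_univ_succ, h0] at e
    rw [Fin.sum_univ_succ x]
    simp only [hlB, Finset.sum_sub_distrib]
    linarith
  rw [e2]
  simp_rw [e1]
  rw [Finset.prod_mul_distrib, ← Complex.exp_sum, ← Finset.mul_sum, ← Complex.ofReal_sum]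
  have key : Complex.exp (s / 2 * ((∑ j, x j : ℝ) : ℂ) - a / 2 * ((∑ j, v j : ℝ) : ℂ)) *
      (Complex.exp (-((s - a) / 2) *
        ((∑ j : Fin k, (Real.log (A j.castSucc) - Real.log (B j)) : ℝ) : ℂ)) *
      Complex.exp (-((s - a) / 2) * (Real.log (A (Fin.last k)) : ℝ))) =
      Complex.exp (a / 2 * ((∑ j, x j : ℝ) : ℂ) - s / 2 * ((∑ j, v j : ℝ) : ℂ)) := by
    rw [← Complex.exp_add, ← Complex.exp_add, ← mul_add, ← Complex.ofReal_add, hlog,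
      Complex.ofReal_add]
    congr 1
    ring
  rw [← key]
  ring

/-! ### Toda eigenfunctions, their size, and the Baxter operator -/

/-- The `GL_n` Toda eigenfunction in logarithmic coordinates. -/
noncomputable def todaPsi : (n : ℕ) → (Fin n → ℂ) → (Fin n → ℝ) → ℂ
  | 0, _, _ => 1
  | n + 1, a, x => ∫ u : Fin n → ℝ, todaKer (a 0) x u * todaPsi n (fun j => a j.succ) u

/-! ### Norms, measurability and growth of the kernels and eigenfunctions. -/

theorem norm_besselKer (ν : ℂ) (A B z : ℝ) :
    ‖besselKer ν A B z‖ = Real.exp (ν.re * z - Real.pi * (A * Real.exp (-z) + B * Real.exp z)) := by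
  rw [besselKer, Complex.norm_exp, Complex.sub_re, Complex.ofReal_re, Complex.re_mul_ofReal]

theorem norm_todaKer {n : ℕ} (a : ℂ) (x : Fin (n + 1) → ℝ) (u : Fin n → ℝ) :
    ‖todaKer a x u‖ = Real.exp (a.re / 2 * x (Fin.last n)) *
      ∏ j : Fin n, todaFactor (a.re / 2) (x j.castSucc) (x j.succ) (u j) := by
  rw [todaKer, norm_mul, norm_prod, Complex.norm_exp, Complex.re_mul_ofReal,
    Complex.div_ofNat_re, Fin.sum_univ_castSucc, mul_add, Real.exp_add, mul_comm (Real.exp _) (Real.exp _), mul_assoc]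
  congr 1
  rw [Finset.mul_sum, Real.exp_sum, ← Finset.prod_mul_distrib]
  refine Finset.prod_congr rfl fun j _ => ?_
  rw [norm_besselKer, todaFactor, ← Real.exp_add]
  congr 1
  simp only [Complex.neg_re, Complex.div_ofNat_re, ← Real.exp_add, sub_eq_add_neg]
  ring_nf

/-- The couplings exp (z_j - x_{j+1}) only help and are discarded; the last coordinate has none
anyway. -/
theorem norm_baxterKer_le {m : ℕ} (s : ℂ) (x z : Fin m → ℝ) :
    ‖baxterKer s x z‖ ≤ ∏ j : Fin m, baxterFactor (s.re / 2) (x j) (z j) := by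
  rw [baxterKer, norm_mul, norm_prod, Complex.norm_exp, Complex.re_mul_ofReal, Finset.mul_sum,
    Real.exp_sum, ← Finset.prod_mul_distrib]
  refine Finset.prod_le_prod (fun j _ => by positivity) fun j _ => ?_
  rw [norm_besselKer, baxterFactor, ← Real.exp_add]
  refine Real.exp_le_exp.2 ?_
  have h : 0 ≤ (Fin.snoc (α := fun _ => ℝ) (fun i => Real.exp (-x i)) 0 : Fin (m + 1) → ℝ)
      j.succ := by
    refine Fin.lastCases ?_ (fun i => ?_) j.succ
    · simp
    · simpa using (Real.exp_pos _).le
  have := mul_nonneg Real.pi_pos.le (mul_nonneg h (Real.exp_pos (z j)).le)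
  simp only [Complex.neg_re, Complex.div_ofNat_re, sub_eq_add_neg (x j), Real.exp_add]
  nlinarith

theorem continuous_todaKer {n : ℕ} (a : ℂ) :
    Continuous fun p : (Fin (n + 1) → ℝ) × (Fin n → ℝ) => todaKer a p.1 p.2 := by
  unfold todaKer besselKer
  fun_prop

theorem continuous_baxterKer {m : ℕ} (s : ℂ) :
    Continuous fun p : (Fin m → ℝ) × (Fin m → ℝ) => baxterKer s p.1 p.2 := by
  have h : ∀ j : Fin (m + 1), Continuous fun p : (Fin m → ℝ) × (Fin m → ℝ) =>
      (Fin.snoc (α := fun _ => ℝ) (fun i => Real.exp (-p.1 i)) 0 : Fin (m + 1) → ℝ) j := by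
    intro j
    refine Fin.lastCases ?_ (fun i => ?_) j
    · simpa using continuous_const
    · simp only [Fin.snoc_castSucc]
      fun_prop
  unfold baxterKer besselKer
  fun_prop (disch := exact h _)

theorem stronglyMeasurable_todaPsi (n : ℕ) (a : Fin n → ℂ) : StronglyMeasurable (todaPsi n a) := by
  induction n with
  | zero => exact stronglyMeasurable_const
  | succ n ih =>
    have : StronglyMeasurable fun p : (Fin (n + 1) → ℝ) × (Fin n → ℝ) =>
        todaKer (a 0) p.1 p.2 * todaPsi n (fun j => a j.succ) p.2 :=
      (continuous_todaKer _).stronglyMeasurable.mul ((ih _).comp_measurable measurable_snd)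
    exact this.integral_prod_right'

theorem integrable_prod_baxterFactor_mul_expBound {m : ℕ} {σ β N : ℝ} (h1 : β < σ) (h2 : -N < σ)
    (x : Fin m → ℝ) : Integrable fun z : Fin m → ℝ =>
      (∏ j, baxterFactor σ (x j) (z j)) * ∏ j, expBound β N (z j) := by
  simp_rw [← Finset.prod_mul_distrib]
  exact Integrable.fintype_prod (f := fun j z => baxterFactor σ (x j) z * expBound β N z)
    fun j => integrable_baxterFactor_mul_expBound h1 h2 (x j)

theorem integral_prod_baxterFactor_mul_expBound_le (m : ℕ) {σ β N : ℝ} (h1 : β < σ)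
    (h2 : -N < σ) : ∃ C, 0 ≤ C ∧ ∀ x : Fin m → ℝ,
      ∫ z : Fin m → ℝ, (∏ j, baxterFactor σ (x j) (z j)) * ∏ j, expBound β N (z j) ≤
        C * ∏ j, expBound β N (x j) := by
  obtain ⟨C, hC, h⟩ := integral_baxterFactor_mul_expBound_le h1 h2
  refine ⟨C ^ m, by positivity, fun x => ?_⟩
  simp_rw [← Finset.prod_mul_distrib]
  rw [integral_fintype_prod_volume_eq_prod
    (fun j z => baxterFactor σ (x j) z * expBound β N z)]
  refine (Finset.prod_le_prod (fun j _ => integral_nonneg fun z =>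
    (mul_pos (baxterFactor_pos _ _ _) (expBound_pos _ _ _)).le) fun j _ => h (x j)).trans_eq ?_
  rw [Finset.prod_mul_distrib]
  simp

theorem integrable_norm_todaKer_mul_expBound {n : ℕ} {a : ℂ} {β N : ℝ} (h1 : a.re / 2 < β)
    (h2 : -N < a.re / 2) (x : Fin (n + 1) → ℝ) : Integrable fun u : Fin n → ℝ =>
      ‖todaKer a x u‖ * ∏ j, expBound β N (u j) := by
  simp_rw [norm_todaKer, mul_assoc, ← Finset.prod_mul_distrib]
  exact (Integrable.fintype_prod (f := fun (j : Fin n) u =>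
    todaFactor (a.re / 2) (x j.castSucc) (x j.succ) u * expBound β N u)
    fun j => integrable_todaFactor_mul_expBound h1 h2 _ _).const_mul _

theorem integral_norm_todaKer_mul_expBound_le (n : ℕ) {a : ℂ} {β N : ℝ} (h1 : a.re / 2 < β)
    (h2 : -N < a.re / 2) : ∃ C, 0 ≤ C ∧ ∀ x : Fin (n + 1) → ℝ,
      ∫ u : Fin n → ℝ, ‖todaKer a x u‖ * ∏ j, expBound β N (u j) ≤
        C * ∏ j, expBound β N (x j) := by
  obtain ⟨C, hC, h⟩ := integral_todaFactor_mul_expBound_le h1 h2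
  set σ := a.re / 2
  refine ⟨C ^ n * 3 ^ (n + 1), by positivity, fun x => ?_⟩
  simp_rw [norm_todaKer, mul_assoc, ← Finset.prod_mul_distrib]
  rw [integral_const_mul, integral_fintype_prod_volume_eq_prod (fun (j : Fin n) u =>
    todaFactor σ (x j.castSucc) (x j.succ) u * expBound β N u)]
  have hE : ∀ c t : ℝ, 1 ≤ 1 + Real.exp (c * t) := fun c t => by
    linarith [Real.exp_pos (c * t)]
  calc Real.exp (σ * x (Fin.last n)) *
      ∏ j : Fin n, ∫ u, todaFactor σ (x j.castSucc) (x j.succ) u * expBound β N u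
      ≤ Real.exp (σ * x (Fin.last n)) * ∏ j : Fin n, (C * (Real.exp (σ * x j.castSucc) *
          (1 + Real.exp (-(N + σ) * x j.castSucc)) * (1 + Real.exp ((β - σ) * x j.succ)))) := by
        refine mul_le_mul_of_nonneg_left (Finset.prod_le_prod (fun j _ => integral_nonneg fun u =>
          ?_) fun j _ => h _ _) (Real.exp_pos _).le
        exact (mul_pos (todaFactor_pos _ _ _ _) (expBound_pos _ _ _)).le
    _ = C ^ n * ((∏ j : Fin n, (Real.exp (σ * x j.castSucc) *
          (1 + Real.exp (-(N + σ) * x j.castSucc)))) * (Real.exp (σ * x (Fin.last n)) * 1) *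
          (1 * ∏ j : Fin n, (1 + Real.exp ((β - σ) * x j.succ)))) := by
        simp only [Finset.prod_mul_distrib]
        simp
        ring
    -- The two end coordinates each occur in only one factor; the missing factors, which are at
    -- least 1, are inserted so that all coordinates look alike.
    _ ≤ C ^ n * ((∏ j : Fin n, (Real.exp (σ * x j.castSucc) *
          (1 + Real.exp (-(N + σ) * x j.castSucc)))) * (Real.exp (σ * x (Fin.last n)) *
          (1 + Real.exp (-(N + σ) * x (Fin.last n)))) *
          ((1 + Real.exp ((β - σ) * x 0)) *
            ∏ j : Fin n, (1 + Real.exp ((β - σ) * x j.succ)))) := by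
        gcongr
        · exact hE _ _
        · exact hE _ _
    _ = C ^ n * ∏ j, (Real.exp (σ * x j) * (1 + Real.exp (-(N + σ) * x j)) *
          (1 + Real.exp ((β - σ) * x j))) := by
        rw [Finset.prod_mul_distrib (f := fun j => Real.exp (σ * x j) *
          (1 + Real.exp (-(N + σ) * x j))), Fin.prod_univ_castSucc (fun j => Real.exp (σ * x j) *
          (1 + Real.exp (-(N + σ) * x j))),
          Fin.prod_univ_succ (fun j => 1 + Real.exp ((β - σ) * x j))]
    _ ≤ C ^ n * ∏ j, (3 * expBound β N (x j)) := by
        refine mul_le_mul_of_nonneg_left (Finset.prod_le_prod (fun j _ => by positivity)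
          fun j _ => exp_mul_one_add_mul_one_add_le h1 h2 _) (by positivity)
    _ = C ^ n * (3 ^ (n + 1) * ∏ j, expBound β N (x j)) := by
        rw [Finset.prod_mul_distrib]
        simp

theorem prod_expBound_pos {n : ℕ} (β N : ℝ) (x : Fin n → ℝ) : 0 < ∏ j, expBound β N (x j) :=
  Finset.prod_pos fun _ _ => expBound_pos _ _ _

/-- Any function of size `expBound` may be integrated against an `expBound`-integrable kernel. -/
theorem integrable_mul_of_norm_le {n : ℕ} {K f : (Fin n → ℝ) → ℂ} {β N C : ℝ}
    (hK : AEStronglyMeasurable K) (hf : AEStronglyMeasurable f)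
    (hb : ∀ u, ‖f u‖ ≤ C * ∏ j, expBound β N (u j))
    (hi : Integrable fun u => ‖K u‖ * ∏ j, expBound β N (u j)) :
    Integrable (fun u => K u * f u) ∧
      ∫ u, ‖K u * f u‖ ≤ C * ∫ u, ‖K u‖ * ∏ j, expBound β N (u j) := by
  have hle : ∀ u, ‖K u * f u‖ ≤ C * (‖K u‖ * ∏ j, expBound β N (u j)) := fun u => by
    rw [norm_mul, mul_left_comm]
    exact mul_le_mul_of_nonneg_left (hb u) (norm_nonneg _)
  have hI : Integrable (fun u => K u * f u) :=
    (hi.const_mul C).mono' (hK.mul hf) (Filter.Eventually.of_forall hle)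
  refine ⟨hI, ?_⟩
  rw [← integral_const_mul]
  exact integral_mono hI.norm (hi.const_mul C) hle

theorem continuous_todaKer_right {n : ℕ} (a : ℂ) (x : Fin (n + 1) → ℝ) :
    Continuous (todaKer a x) :=
  (continuous_todaKer a).comp (Continuous.prodMk_right x)

theorem continuous_baxterKer_right {m : ℕ} (s : ℂ) (x : Fin m → ℝ) :
    Continuous (baxterKer s x) :=
  (continuous_baxterKer s).comp (Continuous.prodMk_right x)

/-- The same β and N serve at every rank because the Toda kernel preserves this class of majorants.
-/
theorem norm_todaPsi_le (n : ℕ) (a : Fin n → ℂ) {β N : ℝ} (h1 : ∀ j, (a j).re / 2 < β)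
    (h2 : ∀ j, -N < (a j).re / 2) :
    ∃ C, 0 ≤ C ∧ ∀ x, ‖todaPsi n a x‖ ≤ C * ∏ j, expBound β N (x j) := by
  induction n with
  | zero => exact ⟨1, zero_le_one, fun x => by simp [todaPsi]⟩
  | succ n ih =>
    obtain ⟨C, hC, h⟩ := ih (fun j => a j.succ) (fun j => h1 _) (fun j => h2 _)
    obtain ⟨D, hD, hd⟩ := integral_norm_todaKer_mul_expBound_le n (h1 0) (h2 0)
    refine ⟨C * D, by positivity, fun x => ?_⟩
    refine (norm_integral_le_integral_norm _).trans ?_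
    refine (integrable_mul_of_norm_le (continuous_todaKer_right _ _).aestronglyMeasurable
      (stronglyMeasurable_todaPsi _ _).aestronglyMeasurable h
      (integrable_norm_todaKer_mul_expBound (h1 0) (h2 0) x)).2.trans ?_
    rw [mul_assoc]
    exact mul_le_mul_of_nonneg_left (hd x) hC

theorem integrable_norm_baxterKer_mul_expBound {m : ℕ} {s : ℂ} {β N : ℝ} (h1 : β < s.re / 2)
    (h2 : -N < s.re / 2) (x : Fin m → ℝ) :
    Integrable fun z : Fin m → ℝ => ‖baxterKer s x z‖ * ∏ j, expBound β N (z j) := by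
  refine (integrable_prod_baxterFactor_mul_expBound h1 h2 x).mono' ?_
    (Filter.Eventually.of_forall fun z => ?_)
  · refine ((continuous_baxterKer_right s x).norm.mul ?_).aestronglyMeasurable
    unfold expBound
    fun_prop
  · rw [Real.norm_eq_abs, abs_of_nonneg (mul_nonneg (norm_nonneg _) (prod_expBound_pos _ _ _).le)]
    exact mul_le_mul_of_nonneg_right (norm_baxterKer_le s x z) (prod_expBound_pos _ _ _).le

theorem integral_norm_baxterKer_mul_expBound_le (m : ℕ) {s : ℂ} {β N : ℝ} (h1 : β < s.re / 2)
    (h2 : -N < s.re / 2) : ∃ C, 0 ≤ C ∧ ∀ x : Fin m → ℝ,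
      ∫ z, ‖baxterKer s x z‖ * ∏ j, expBound β N (z j) ≤ C * ∏ j, expBound β N (x j) := by
  obtain ⟨C, hC, h⟩ := integral_prod_baxterFactor_mul_expBound_le m h1 h2
  refine ⟨C, hC, fun x => le_trans (integral_mono
    (integrable_norm_baxterKer_mul_expBound h1 h2 x)
    (integrable_prod_baxterFactor_mul_expBound h1 h2 x) fun z => ?_) (h x)⟩
  exact mul_le_mul_of_nonneg_right (norm_baxterKer_le s x z) (prod_expBound_pos _ _ _).le

/-- Absolute integrability of a composition of kernels, from `expBound` estimates. -/
theorem integrable_kernel_comp {m k : ℕ} {K : (Fin m → ℝ) → ℂ}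
    {H : (Fin m → ℝ) → (Fin k → ℝ) → ℂ} {f : (Fin k → ℝ) → ℂ} {β N C D : ℝ}
    (hK : Continuous K) (hH : Continuous fun p : (Fin m → ℝ) × (Fin k → ℝ) => H p.1 p.2)
    (hf : StronglyMeasurable f) (hC : 0 ≤ C)
    (hb : ∀ v, ‖f v‖ ≤ C * ∏ j, expBound β N (v j))
    (hHi : ∀ z, Integrable fun v => ‖H z v‖ * ∏ j, expBound β N (v j))
    (hHb : ∀ z, ∫ v, ‖H z v‖ * ∏ j, expBound β N (v j) ≤ D * ∏ j, expBound β N (z j))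
    (hKi : Integrable fun z => ‖K z‖ * ∏ j, expBound β N (z j)) :
    Integrable (fun p : (Fin m → ℝ) × (Fin k → ℝ) => K p.1 * (H p.1 p.2 * f p.2))
      (volume.prod volume) := by
  have hm : StronglyMeasurable
      (fun p : (Fin m → ℝ) × (Fin k → ℝ) => K p.1 * (H p.1 p.2 * f p.2)) :=
    (hK.stronglyMeasurable.comp_measurable measurable_fst).mul
      (hH.stronglyMeasurable.mul (hf.comp_measurable measurable_snd))
  have hz : ∀ z, Integrable (fun v => H z v * f v) ∧
      ∫ v, ‖H z v * f v‖ ≤ C * ∫ v, ‖H z v‖ * ∏ j, expBound β N (v j) := fun z =>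
    integrable_mul_of_norm_le (hH.comp (Continuous.prodMk_right z)).aestronglyMeasurable
      hf.aestronglyMeasurable hb (hHi z)
  refine (integrable_prod_iff hm.aestronglyMeasurable).2
    ⟨Filter.Eventually.of_forall fun z => (hz z).1.const_mul (K z), ?_⟩
  refine (hKi.const_mul (C * D)).mono' hm.norm.integral_prod_right'.aestronglyMeasurable
    (Filter.Eventually.of_forall fun z => ?_)
  rw [Real.norm_eq_abs, abs_of_nonneg (integral_nonneg fun _ => norm_nonneg _)]
  simp_rw [norm_mul (K z)]
  rw [integral_const_mul]
  calc ‖K z‖ * ∫ v, ‖H z v * f v‖ ≤ ‖K z‖ * (C * (D * ∏ j, expBound β N (z j))) := by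
        gcongr
        exact (hz z).2.trans (mul_le_mul_of_nonneg_left (hHb z) hC)
    _ = C * D * (‖K z‖ * ∏ j, expBound β N (z j)) := by ring

/-- The finitely many strict inequalities leave room for β just below σ; N is any large number. -/
theorem exists_expBound_exponents {n : ℕ} (a : Fin n → ℂ) {σ : ℝ} (h : ∀ j, (a j).re / 2 < σ) :
    ∃ β N : ℝ, β < σ ∧ -N < σ ∧ (∀ j, (a j).re / 2 < β) ∧ ∀ j, -N < (a j).re / 2 := by
  obtain ⟨β, hβ, hβ'⟩ : ∃ β, β < σ ∧ ∀ j, (a j).re / 2 < β := by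
    have : ∀ᶠ β in nhdsWithin σ (Set.Iio σ), β < σ ∧ ∀ j, (a j).re / 2 < β := by
      refine (eventually_mem_nhdsWithin).and (Filter.eventually_all.2 fun j => ?_)
      exact mem_nhdsWithin_of_mem_nhds (Ioi_mem_nhds (h j))
    exact this.exists
  have : ∀ᶠ N : ℝ in Filter.atTop, -σ < N ∧ ∀ j, -((a j).re / 2) < N :=
    (Filter.eventually_gt_atTop _).and
      (Filter.eventually_all.2 fun j => Filter.eventually_gt_atTop _)
  obtain ⟨N, h1, h2⟩ := this.exists
  exact ⟨β, N, hβ, by linarith, hβ', fun j => by linarith [h2 j]⟩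

/-- The Toda eigenfunctions diagonalize the Baxter operator. -/
theorem integral_baxterKer_mul_todaPsi (m : ℕ) (a : Fin m → ℂ) (s : ℂ)
    (h : ∀ j, (a j).re < s.re) (x : Fin m → ℝ) :
    ∫ z, baxterKer s x z * todaPsi m a z = (∏ j, Complex.Gammaℝ (s - a j)) * todaPsi m a x := by
  induction m with
  | zero => simp [baxterKer, todaPsi, volume_pi, measureReal_def]
  | succ k ih =>
    obtain ⟨β, N, hβ, hN, h1, h2⟩ := exists_expBound_exponents a (σ := s.re / 2)
      fun j => by linarith [h j]
    set a' : Fin k → ℂ := fun j => a j.succ with ha'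
    obtain ⟨C, hC, hCb⟩ := norm_todaPsi_le k a' (β := β) (N := N) (fun j => h1 _) (fun j => h2 _)
    obtain ⟨D, -, hD⟩ := integral_norm_todaKer_mul_expBound_le k (h1 0) (h2 0)
    obtain ⟨E, -, hE⟩ := integral_norm_baxterKer_mul_expBound_le k hβ hN
    have i1 := integrable_kernel_comp (continuous_baxterKer_right s x) (continuous_todaKer (a 0))
      (stronglyMeasurable_todaPsi k a') hC hCb
      (fun z => integrable_norm_todaKer_mul_expBound (h1 0) (h2 0) z) hD
      (integrable_norm_baxterKer_mul_expBound hβ hN x)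
    have i2 := integrable_kernel_comp (continuous_todaKer_right (a 0) x) (continuous_baxterKer s)
      (stronglyMeasurable_todaPsi k a') hC hCb
      (fun z => integrable_norm_baxterKer_mul_expBound hβ hN z) hE
      (integrable_norm_todaKer_mul_expBound (h1 0) (h2 0) x)
    calc ∫ z, baxterKer s x z * todaPsi (k + 1) a z
        = ∫ z, ∫ v, baxterKer s x z * (todaKer (a 0) z v * todaPsi k a' v) := by
          simp_rw [integral_const_mul]
          rfl
      _ = ∫ v, ∫ z, baxterKer s x z * (todaKer (a 0) z v * todaPsi k a' v) :=
          integral_integral_swap i1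
      -- Commutation moves the Baxter operator past the outer Toda kernel, down to the rank of the
      -- induction hypothesis.
      _ = ∫ v, Complex.Gammaℝ (s - a 0) *
            ∫ u, todaKer (a 0) x u * (baxterKer s u v * todaPsi k a' v) := by
          congr 1
          ext v
          simp_rw [← mul_assoc]
          rw [integral_mul_const, integral_mul_const, integral_baxterKer_mul_todaKer (h 0),
            mul_assoc]
      _ = Complex.Gammaℝ (s - a 0) *
            ∫ u, ∫ v, todaKer (a 0) x u * (baxterKer s u v * todaPsi k a' v) := by
          rw [integral_const_mul]
          congr 1
          exact (integral_integral_swap i2).symm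
      _ = Complex.Gammaℝ (s - a 0) *
            ∫ u, (∏ j, Complex.Gammaℝ (s - a' j)) * (todaKer (a 0) x u * todaPsi k a' u) := by
          congr 2
          ext u
          rw [integral_const_mul, ih a' (fun j => h _)]
          ring
      _ = _ := by
          rw [integral_const_mul, Fin.prod_univ_succ, mul_assoc]
          rfl

/-! ### The iterated Gaussian integral -/

/-- One factor of the iterated Gaussian integrand. -/
noncomputable def gaussFactor (L L' z x x' q : ℝ) : ℂ :=
  Complex.exp ((((L - z) / 2 - Real.pi * (Real.exp (L - z) * ((x ^ 2 + q) / q)) -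
      Real.pi * (Real.exp (z - L') * ((q - x' ^ 2) / q)) - Real.log q / 2 : ℝ) : ℂ) +
    -2 * Real.pi * Complex.I * ((x * x' / q * Real.exp ((L - L') / 2) : ℝ) : ℂ))

theorem gaussFactor_eq (L L' z x' : ℝ) {q : ℝ} (hq : 0 < q) (x : ℝ) :
    gaussFactor L L' z x x' q = Complex.exp (((-(Real.pi * Real.exp (L - z) / q) : ℝ) : ℂ) * x ^ 2 +
      (-2 * Real.pi * Complex.I * ((x' / q * Real.exp ((L - L') / 2) : ℝ) : ℂ)) * x +
      (((L - z) / 2 - Real.pi * Real.exp (L - z) -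
        Real.pi * (Real.exp (z - L') * ((q - x' ^ 2) / q)) - Real.log q / 2 : ℝ) : ℂ)) := by
  rw [gaussFactor, add_div, div_self hq.ne']
  congr 1
  push_cast
  ring

theorem integrable_gaussFactor (L L' z x' : ℝ) {q : ℝ} (hq : 0 < q) :
    Integrable fun x => gaussFactor L L' z x x' q := by
  simp_rw [gaussFactor_eq L L' z x' hq]
  refine integrable_cexp_quadratic' ?_ _ _
  rw [Complex.ofReal_re]
  have := Real.pi_pos
  have := Real.exp_pos (L - z)
  have : 0 < Real.pi * Real.exp (L - z) / q := by positivity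
  linarith

/-- The Fourier transform of the Gaussian contributes exp (π (x'²/q) exp (z - L')) to the negative
power, i.e. with a minus sign, which completes (q - x'²)/q to 1. The result no longer involves x' or
q, so the next variable can be integrated in the same way. -/
theorem integral_gaussFactor (L L' z x' : ℝ) {q : ℝ} (hq : 0 < q) :
    ∫ x, gaussFactor L L' z x x' q =
      Real.exp (-(Real.pi * (Real.exp (L - z) + Real.exp (z - L')))) := by
  have hb : 0 < Real.pi * Real.exp (L - z) / q := by
    have := Real.pi_pos
    positivity
  simp_rw [gaussFactor_eq L L' z x' hq]
  rw [integral_cexp_quadratic (by rw [Complex.ofReal_re]; linarith)]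
  have h1 : ((Real.pi : ℂ) / -((-(Real.pi * Real.exp (L - z) / q) : ℝ) : ℂ)) ^ (1 / 2 : ℂ) =
      Complex.exp (((Real.log q + z - L) / 2 : ℝ) : ℂ) := by
    have : (Real.pi : ℂ) / -((-(Real.pi * Real.exp (L - z) / q) : ℝ) : ℂ) =
        ((Real.exp (Real.log q + z - L) : ℝ) : ℂ) := by
      rw [show Real.log q + z - L = Real.log q - (L - z) by ring, Real.exp_sub (Real.log q),
        Real.exp_log hq, ← Complex.ofReal_neg, ← Complex.ofReal_div]
      congr 1
      have := Real.pi_pos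
      field_simp
    rw [this, Complex.cpow_def_of_ne_zero (by exact_mod_cast (Real.exp_pos _).ne'),
      ← Complex.ofReal_log (Real.exp_pos _).le, Real.log_exp]
    congr 1
    push_cast
    ring
  rw [h1, ← Complex.exp_add, Complex.ofReal_exp]
  congr 1
  have h2 : (-2 * (Real.pi : ℂ) * Complex.I *
      ((x' / q * Real.exp ((L - L') / 2) : ℝ) : ℂ)) ^ 2 /
      (4 * ((-(Real.pi * Real.exp (L - z) / q) : ℝ) : ℂ)) =
      ((Real.pi * (x' ^ 2 / q) * Real.exp (z - L') : ℝ) : ℂ) := by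
    rw [mul_pow, mul_pow, Complex.I_sq]
    have e : Real.exp ((L - L') / 2) ^ 2 = Real.exp (z - L') * Real.exp (L - z) := by
      rw [← Real.exp_nat_mul, ← Real.exp_add]
      push_cast
      ring_nf
    have : (-2 * (Real.pi : ℂ)) ^ 2 * -1 * ((x' / q * Real.exp ((L - L') / 2) : ℝ) : ℂ) ^ 2 /
        (4 * ((-(Real.pi * Real.exp (L - z) / q) : ℝ) : ℂ)) =
        (((-2 * Real.pi) ^ 2 * -1 * (x' / q * Real.exp ((L - L') / 2)) ^ 2 /
          (4 * -(Real.pi * Real.exp (L - z) / q)) : ℝ) : ℂ) := by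
      push_cast
      ring
    rw [this, mul_pow (x' / q), e]
    congr 1
    have := Real.pi_pos
    have := Real.exp_pos (L - z)
    field_simp
    ring
  rw [h2, ← Complex.ofReal_sub, ← Complex.ofReal_add]
  congr 1
  field_simp
  ring

/-- Without oscillation the decay in exp (z - L') is lost, since q - x'² may vanish. What survives
is uniform in x' and q, which suffices for Fubini. -/
theorem integral_norm_gaussFactor_le (L L' z x' : ℝ) {q : ℝ} (hq : 0 < q) (hx : x' ^ 2 ≤ q) :
    ∫ x, ‖gaussFactor L L' z x x' q‖ ≤ Real.exp (-(Real.pi * Real.exp (L - z))) := by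
  have hb : 0 < Real.pi * Real.exp (L - z) / q := by
    have := Real.pi_pos
    positivity
  have h : ∀ x, ‖gaussFactor L L' z x x' q‖ = Real.exp ((L - z) / 2 - Real.pi * Real.exp (L - z) -
      Real.pi * (Real.exp (z - L') * ((q - x' ^ 2) / q)) - Real.log q / 2) *
      Real.exp (-(Real.pi * Real.exp (L - z) / q) * x ^ 2) := by
    intro x
    rw [gaussFactor, Complex.norm_exp, ← Real.exp_add, Complex.add_re, Complex.ofReal_re,
      Complex.re_mul_ofReal]
    congr 1
    have : (-2 * (Real.pi : ℂ) * Complex.I).re = 0 := by simp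
    rw [this, add_div, div_self hq.ne']
    ring
  simp_rw [h]
  rw [integral_const_mul, integral_gaussian]
  have h1 : √(Real.pi / (Real.pi * Real.exp (L - z) / q)) =
      Real.exp ((Real.log q - (L - z)) / 2) := by
    rw [Real.exp_half, Real.exp_sub (Real.log q), Real.exp_log hq]
    congr 1
    have := Real.pi_pos
    field_simp
  rw [h1, ← Real.exp_add]
  refine Real.exp_le_exp.2 ?_
  have : 0 ≤ Real.pi * (Real.exp (z - L') * ((q - x' ^ 2) / q)) :=
    mul_nonneg Real.pi_pos.le (mul_nonneg (Real.exp_pos _).le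
      (div_nonneg (sub_nonneg.2 hx) hq.le))
  linarith

/-! ### The partial sums q_j, the extended vector x, and the Gaussian chain. -/

theorem qSum_pos {m : ℕ} (x : Fin m → ℝ) (j : ℕ) : 0 < qSum x j := by
  have : 0 ≤ ∑ p ∈ Finset.univ.filter (fun p : Fin m => j ≤ (p : ℕ)), x p ^ 2 :=
    Finset.sum_nonneg fun _ _ => sq_nonneg _
  unfold qSum
  linarith

theorem qSum_of_le {m : ℕ} (x : Fin m → ℝ) {j : ℕ} (h : m ≤ j) : qSum x j = 1 := by
  rw [qSum, Finset.filter_false_of_mem fun p _ => by omega]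
  simp

theorem qSum_cons_succ {m : ℕ} (x₀ : ℝ) (x : Fin m → ℝ) (j : ℕ) :
    qSum (Fin.cons (α := fun _ => ℝ) x₀ x : Fin (m + 1) → ℝ) (j + 1) = qSum x j := by
  simp only [qSum, Finset.sum_filter]
  rw [Fin.sum_univ_succ]
  simp

theorem qSum_castSucc {m : ℕ} (x : Fin m → ℝ) (j : Fin m) :
    qSum x j = x j ^ 2 + qSum x (j + 1) := by
  have : Finset.univ.filter (fun p : Fin m => (j : ℕ) ≤ p) =
      insert j (Finset.univ.filter fun p : Fin m => (j : ℕ) + 1 ≤ p) := by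
    ext p
    simp only [Finset.mem_filter, Finset.mem_univ, true_and, Finset.mem_insert, Fin.ext_iff]
    omega
  rw [qSum, qSum, this, Finset.sum_insert (by simp)]
  ring

theorem xExt_castSucc {m : ℕ} (x : Fin m → ℝ) (j : Fin m) : xExt x j.castSucc = x j := by
  simp [xExt]

theorem xExt_last {m : ℕ} (x : Fin m → ℝ) : xExt x (Fin.last m) = 1 := by
  simp [xExt]

theorem xExt_cons_succ {m : ℕ} (x₀ : ℝ) (x : Fin m → ℝ) (j : Fin (m + 1)) :
    xExt (Fin.cons (α := fun _ => ℝ) x₀ x : Fin (m + 1) → ℝ) j.succ = xExt x j := by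
  rw [xExt, ← Fin.cons_snoc_eq_snoc_cons, Fin.cons_succ, xExt]

theorem xExt_sq_le_qSum {m : ℕ} (x : Fin m → ℝ) (j : Fin (m + 1)) : xExt x j ^ 2 ≤ qSum x j := by
  refine Fin.lastCases ?_ (fun i => ?_) j
  · rw [xExt_last, Fin.val_last, qSum_of_le x le_rfl, one_pow]
  · rw [xExt_castSucc, Fin.val_castSucc, qSum_castSucc]
    linarith [qSum_pos x (i + 1)]

/-- The iterated Gaussian integrand. -/
noncomputable def gaussChain {m : ℕ} (L : Fin (m + 1) → ℝ) (z x : Fin m → ℝ) : ℂ :=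
  ∏ j : Fin m, gaussFactor (L j.castSucc) (L j.succ) (z j) (x j) (xExt x j.succ) (qSum x (j + 1))

theorem gaussChain_cons {m : ℕ} (L : Fin (m + 2) → ℝ) (z : Fin (m + 1) → ℝ) (x₀ : ℝ)
    (x : Fin m → ℝ) : gaussChain L z (Fin.cons (α := fun _ => ℝ) x₀ x) =
      gaussFactor (L 0) (L 1) (z 0) x₀ (xExt x 0) (qSum x 0) *
        gaussChain (fun j => L j.succ) (fun j => z j.succ) x := by
  have h : xExt (Fin.cons (α := fun _ => ℝ) x₀ x : Fin (m + 1) → ℝ) 1 = xExt x 0 :=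
    xExt_cons_succ x₀ x 0
  rw [gaussChain, Fin.prod_univ_succ, gaussChain]
  simp only [xExt_cons_succ, qSum_cons_succ, Fin.cons_zero, Fin.cons_succ, Fin.castSucc_zero,
    Fin.succ_zero_eq_one, Fin.val_zero, Fin.val_succ, Fin.succ_castSucc, h]

theorem measurable_qSum {m : ℕ} (j : ℕ) : Measurable fun x : Fin m → ℝ => qSum x j := by
  unfold qSum
  fun_prop

theorem measurable_xExt {m : ℕ} (j : Fin (m + 1)) : Measurable fun x : Fin m → ℝ => xExt x j := by
  refine Fin.lastCases ?_ (fun i => ?_) j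
  · simp only [xExt_last]
    fun_prop
  · simp only [xExt_castSucc]
    fun_prop

theorem measurable_gaussChain {m : ℕ} (L : Fin (m + 1) → ℝ) :
    Measurable fun p : (Fin m → ℝ) × (Fin m → ℝ) => gaussChain L p.2 p.1 := by
  have h1 : ∀ j, Measurable fun p : (Fin m → ℝ) × (Fin m → ℝ) => qSum p.1 j := fun j =>
    (measurable_qSum j).comp measurable_fst
  have h2 : ∀ j, Measurable fun p : (Fin m → ℝ) × (Fin m → ℝ) => xExt p.1 j := fun j =>
    (measurable_xExt j).comp measurable_fst
  unfold gaussChain gaussFactor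
  fun_prop (disch := first | exact h1 _ | exact h2 _)

theorem measurable_gaussChain_right {m : ℕ} (L : Fin (m + 1) → ℝ) (z : Fin m → ℝ) :
    Measurable (gaussChain L z) := by
  have h1 : ∀ j, Measurable fun x : Fin m → ℝ => qSum x j := measurable_qSum
  have h2 : ∀ j, Measurable fun x : Fin m → ℝ => xExt x j := measurable_xExt
  unfold gaussChain gaussFactor
  fun_prop (disch := first | exact h1 _ | exact h2 _)

theorem measurePreserving_cons (m : ℕ) : MeasurePreserving
    (fun p : ℝ × (Fin m → ℝ) => (Fin.cons (α := fun _ => ℝ) p.1 p.2 : Fin (m + 1) → ℝ))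
    (volume.prod volume) volume := by
  have h := (volume_preserving_piFinSuccAbove (fun _ : Fin (m + 1) => ℝ) 0).symm
  have e : ⇑(MeasurableEquiv.piFinSuccAbove (fun _ : Fin (m + 1) => ℝ) 0).symm =
      fun p : ℝ × (Fin m → ℝ) => (Fin.cons (α := fun _ => ℝ) p.1 p.2 : Fin (m + 1) → ℝ) := by
    ext p : 1
    simp [MeasurableEquiv.piFinSuccAbove_symm_apply, Fin.insertNthEquiv]
  rw [e] at h
  exact h

theorem measurableEmbedding_cons (m : ℕ) : MeasurableEmbedding
    (fun p : ℝ × (Fin m → ℝ) => (Fin.cons (α := fun _ => ℝ) p.1 p.2 : Fin (m + 1) → ℝ)) := by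
  have h := (MeasurableEquiv.piFinSuccAbove (fun _ : Fin (m + 1) => ℝ) 0).symm.measurableEmbedding
  have e : ⇑(MeasurableEquiv.piFinSuccAbove (fun _ : Fin (m + 1) => ℝ) 0).symm =
      fun p : ℝ × (Fin m → ℝ) => (Fin.cons (α := fun _ => ℝ) p.1 p.2 : Fin (m + 1) → ℝ) := by
    ext p : 1
    simp [MeasurableEquiv.piFinSuccAbove_symm_apply, Fin.insertNthEquiv]
  rw [e] at h
  exact h

/-- Induction from the first variable: x₁ enters only the first factor, because the later ones
involve only x₂, x₃, … and their partial sums. The norm bound is proved along with the value to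
justify each exchange. -/
theorem gaussChain_integral {m : ℕ} (L : Fin (m + 1) → ℝ) (z : Fin m → ℝ) :
    Integrable (gaussChain L z) ∧
    ∫ x, gaussChain L z x = Real.exp (-(Real.pi * ∑ j : Fin m,
      (Real.exp (L j.castSucc - z j) + Real.exp (z j - L j.succ)))) ∧
    ∫ x, ‖gaussChain L z x‖ ≤
      Real.exp (-(Real.pi * ∑ j : Fin m, Real.exp (L j.castSucc - z j))) := by
  induction m with
  | zero =>
    refine ⟨Integrable.of_finite, ?_, ?_⟩ <;> simp [gaussChain, volume_pi, measureReal_def]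
  | succ m ih =>
    obtain ⟨i1, i2, i3⟩ := ih (fun j => L j.succ) (fun j => z j.succ)
    set G : (Fin m → ℝ) → ℂ := gaussChain (fun j => L j.succ) (fun j => z j.succ)
    have hmeas : Measurable fun p : ℝ × (Fin m → ℝ) =>
        gaussChain L z (Fin.cons (α := fun _ => ℝ) p.1 p.2) :=
      Measurable.comp (g := gaussChain L z) (measurable_gaussChain_right L z)
        (measurePreserving_cons m).measurable
    have hI : Integrable (fun p : ℝ × (Fin m → ℝ) =>
        gaussChain L z (Fin.cons (α := fun _ => ℝ) p.1 p.2)) (volume.prod volume) := by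
      refine (integrable_prod_iff' hmeas.aestronglyMeasurable).2
        ⟨Filter.Eventually.of_forall fun x => ?_, ?_⟩
      · simp only [gaussChain_cons]
        exact (integrable_gaussFactor _ _ _ _ (qSum_pos x 0)).mul_const _
      · simp only [gaussChain_cons, norm_mul]
        simp_rw [integral_mul_const]
        refine (i1.norm.const_mul (Real.exp (-(Real.pi * Real.exp (L 0 - z 0))))).mono' ?_
          (Filter.Eventually.of_forall fun x => ?_)
        · have h := (hmeas.comp measurable_swap).stronglyMeasurable.norm.integral_prod_right'
            (ν := (volume : Measure ℝ))
          simp only [Function.comp_apply, Prod.fst_swap, Prod.snd_swap, gaussChain_cons, norm_mul,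
            integral_mul_const] at h
          exact h.aestronglyMeasurable
        · rw [norm_mul, norm_norm, Real.norm_eq_abs,
            abs_of_nonneg (integral_nonneg fun _ => norm_nonneg _)]
          exact mul_le_mul_of_nonneg_right (integral_norm_gaussFactor_le _ _ _ _ (qSum_pos x 0)
            (xExt_sq_le_qSum x 0)) (norm_nonneg _)
    refine ⟨((measurePreserving_cons m).integrable_comp_emb (measurableEmbedding_cons m)).1 hI,
      ?_, ?_⟩
    · rw [← (measurePreserving_cons m).integral_comp (measurableEmbedding_cons m),
        integral_prod_symm _ hI]
      simp only [gaussChain_cons]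
      simp_rw [integral_mul_const, integral_gaussFactor _ _ _ _ (qSum_pos _ 0)]
      rw [integral_const_mul, i2, ← Complex.ofReal_mul, ← Real.exp_add, Fin.sum_univ_succ]
      simp only [Fin.castSucc_zero, Fin.succ_zero_eq_one, Fin.succ_castSucc]
      ring_nf
    · rw [← (measurePreserving_cons m).integral_comp (measurableEmbedding_cons m),
        integral_prod_symm _ hI.norm]
      simp only [gaussChain_cons, norm_mul]
      simp_rw [integral_mul_const]
      calc ∫ x, (∫ x₀, ‖gaussFactor (L 0) (L 1) (z 0) x₀ (xExt x 0) (qSum x 0)‖) * ‖G x‖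
          ≤ ∫ x, Real.exp (-(Real.pi * Real.exp (L 0 - z 0))) * ‖G x‖ := by
            refine integral_mono_of_nonneg (Filter.Eventually.of_forall fun x =>
              mul_nonneg (integral_nonneg fun _ => norm_nonneg _) (norm_nonneg _))
              (i1.norm.const_mul _) (Filter.Eventually.of_forall fun x => ?_)
            exact mul_le_mul_of_nonneg_right (integral_norm_gaussFactor_le _ _ _ _
              (qSum_pos x 0) (xExt_sq_le_qSum x 0)) (norm_nonneg _)
        _ ≤ Real.exp (-(Real.pi * Real.exp (L 0 - z 0))) *
            Real.exp (-(Real.pi * ∑ j : Fin m, Real.exp (L j.castSucc.succ - z j.succ))) := by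
            rw [integral_const_mul]
            exact mul_le_mul_of_nonneg_left i3 (Real.exp_pos _).le
        _ = _ := by
            rw [← Real.exp_add, Fin.sum_univ_succ]
            simp only [Fin.castSucc_zero, Fin.succ_castSucc]
            ring_nf

/-! ### The Baxter kernel at the shifted point -/

/-- The logarithmic coordinates of the torus part in the Iwasawa decomposition. -/
noncomputable def logShift {m : ℕ} (L : Fin (m + 1) → ℝ) (x : Fin m → ℝ) : Fin m → ℝ :=
  fun j => L j.castSucc + Real.log (qSum x j) - Real.log (qSum x (j + 1))

theorem sum_log_qSum_sub {m : ℕ} (x : Fin m → ℝ) :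
    ∑ j : Fin m, (Real.log (qSum x j) - Real.log (qSum x (j + 1))) = Real.log (qSum x 0) := by
  rw [Fin.sum_univ_eq_sum_range (fun j => Real.log (qSum x j) - Real.log (qSum x (j + 1))),
    Finset.sum_range_sub', qSum_of_le x le_rfl, Real.log_one, sub_zero]

/-- For an interior index this is q_j - x_j² = q_{j+1}. At the last index x_n = q_n = 1 makes the
quotient vanish, in agreement with the missing coupling of the Baxter kernel. -/
theorem snoc_exp_neg_logShift {m : ℕ} (L : Fin (m + 1) → ℝ) (x : Fin m → ℝ) (j : Fin (m + 1)) :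
    (Fin.snoc (α := fun _ => ℝ) (fun i => Real.exp (-logShift L x i)) 0 : Fin (m + 1) → ℝ) j =
      Real.exp (-L j) * ((qSum x j - xExt x j ^ 2) / qSum x j) := by
  refine Fin.lastCases ?_ (fun i => ?_) j
  · rw [Fin.snoc_last, xExt_last, Fin.val_last, qSum_of_le x le_rfl]
    simp
  · rw [Fin.snoc_castSucc, xExt_castSucc, logShift, Fin.val_castSucc,
      show -(L i.castSucc + Real.log (qSum x i) - Real.log (qSum x (i + 1))) =
        -L i.castSucc + (Real.log (qSum x (i + 1)) - Real.log (qSum x i)) by ring,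
      Real.exp_add, Real.exp_sub, Real.exp_log (qSum_pos _ _), Real.exp_log (qSum_pos _ _),
      show qSum x i - x i ^ 2 = qSum x (i + 1) by rw [qSum_castSucc]; ring]

/-- The shift s + 1 supplies the terms (L - z)/2 of the Gaussian factors and an extra (log q_1)/2.
The latter turns -(1/2) ∑ log q_j into -(1/2) ∑ log q_{j+1}, the normalization of the Gaussians. -/
theorem baxterKer_logShift {m : ℕ} (s : ℂ) (L : Fin (m + 1) → ℝ) (z x : Fin m → ℝ) :
    baxterKer (s + 1) (logShift L x) z *
      (Complex.exp (-2 * Real.pi * Complex.I * ((∑ j : Fin m, xExt x j.castSucc * xExt x j.succ /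
          qSum x (j + 1) * Real.exp ((L j.castSucc - L j.succ) / 2) : ℝ) : ℂ)) *
        Complex.exp (-(s / 2) * (Real.log (qSum x 0) : ℝ)) *
        ∏ j : Fin m, ((1 / Real.sqrt (qSum x j) : ℝ) : ℂ)) =
      Complex.exp (s / 2 * ((∑ j : Fin m, L j.castSucc - ∑ j, z j : ℝ) : ℂ)) *
        gaussChain L z x := by
  have hs : ∏ j : Fin m, ((1 / Real.sqrt (qSum x j) : ℝ) : ℂ) =
      Complex.exp ((∑ j : Fin m, -(Real.log (qSum x j) / 2) : ℝ) : ℂ) := by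
    rw [Complex.ofReal_sum, Complex.exp_sum]
    refine Finset.prod_congr rfl fun j _ => ?_
    rw [← Complex.ofReal_exp, Real.exp_neg, Real.exp_half, Real.exp_log (qSum_pos _ _), one_div]
  have hX : ∑ j, logShift L x j = ∑ j : Fin m, L j.castSucc + Real.log (qSum x 0) := by
    rw [← sum_log_qSum_sub x, ← Finset.sum_add_distrib]
    exact Finset.sum_congr rfl fun j _ => by rw [logShift]; ring
  have h1 : ∑ j, Real.exp (logShift L x j) * Real.exp (-z j) = ∑ j : Fin m,
      Real.exp (L j.castSucc - z j) * ((x j ^ 2 + qSum x (j + 1)) / qSum x (j + 1)) := by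
    refine Finset.sum_congr rfl fun j _ => ?_
    rw [← qSum_castSucc, ← Real.exp_add, logShift, show L j.castSucc + Real.log (qSum x j) -
      Real.log (qSum x (j + 1)) + -z j = L j.castSucc - z j + (Real.log (qSum x j) -
      Real.log (qSum x (j + 1))) by ring, Real.exp_add,
      Real.exp_sub (Real.log (qSum x j)),
      Real.exp_log (qSum_pos _ _), Real.exp_log (qSum_pos _ _)]
  have h2 : ∑ j : Fin m, (Fin.snoc (α := fun _ => ℝ) (fun i => Real.exp (-logShift L x i)) 0 :
      Fin (m + 1) → ℝ) j.succ * Real.exp (z j) = ∑ j : Fin m, Real.exp (z j - L j.succ) *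
        ((qSum x (j + 1) - xExt x j.succ ^ 2) / qSum x (j + 1)) := by
    refine Finset.sum_congr rfl fun j _ => ?_
    rw [snoc_exp_neg_logShift, Fin.val_succ, sub_eq_add_neg (z j), Real.exp_add]
    ring
  have h3 := sum_log_qSum_sub x
  rw [Finset.sum_sub_distrib] at h3
  rw [baxterKer_eq, hs, hX, h1, h2, gaussChain]
  simp only [gaussFactor]
  rw [← Complex.exp_sum, ← Complex.exp_add, ← Complex.exp_add, ← Complex.exp_add,
    ← Complex.exp_add, Finset.sum_add_distrib, ← Finset.mul_sum, ← Complex.ofReal_sum,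
    ← Complex.ofReal_sum]
  congr 1
  have hr : (∑ j : Fin m, ((L j.castSucc - z j) / 2 - Real.pi * (Real.exp (L j.castSucc - z j) *
      ((x j ^ 2 + qSum x (j + 1)) / qSum x (j + 1))) - Real.pi * (Real.exp (z j - L j.succ) *
        ((qSum x (j + 1) - xExt x j.succ ^ 2) / qSum x (j + 1))) -
        Real.log (qSum x (j + 1)) / 2)) =
      (∑ j : Fin m, L j.castSucc + Real.log (qSum x 0) - ∑ j, z j) / 2 -
      Real.pi * (∑ j : Fin m,
      Real.exp (L j.castSucc - z j) * ((x j ^ 2 + qSum x (j + 1)) / qSum x (j + 1)) +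
      ∑ j : Fin m, Real.exp (z j - L j.succ) *
        ((qSum x (j + 1) - xExt x j.succ ^ 2) / qSum x (j + 1))) +
      ∑ j : Fin m, -(Real.log (qSum x j) / 2) := by
    simp only [Finset.sum_sub_distrib, Finset.sum_neg_distrib, ← Finset.mul_sum,
      ← Finset.sum_div]
    linarith
  rw [hr]
  simp only [xExt_castSucc]
  push_cast
  ring

/-- The weight of the Jacquet-type integral in logarithmic coordinates. -/
noncomputable def jacquetWeight {m : ℕ} (s : ℂ) (L : Fin (m + 1) → ℝ) (x : Fin m → ℝ) : ℂ :=
  Complex.exp (-2 * Real.pi * Complex.I * ((∑ j : Fin m, xExt x j.castSucc * xExt x j.succ /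
      qSum x (j + 1) * Real.exp ((L j.castSucc - L j.succ) / 2) : ℝ) : ℂ)) *
    Complex.exp (-(s / 2) * (Real.log (qSum x 0) : ℝ)) *
    ∏ j : Fin m, ((1 / Real.sqrt (qSum x j) : ℝ) : ℂ)

theorem norm_exp_mul_prod_baxterFactor {m : ℕ} (s : ℂ) (x z : Fin m → ℝ) :
    ‖Complex.exp (s / 2 * ((∑ j : Fin m, x j - ∑ j, z j : ℝ) : ℂ))‖ *
      Real.exp (-(Real.pi * ∑ j : Fin m, Real.exp (x j - z j))) =
      ∏ j, baxterFactor (s.re / 2) (x j) (z j) := by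
  rw [Complex.norm_exp, Complex.re_mul_ofReal, ← Real.exp_add]
  simp only [baxterFactor]
  rw [← Real.exp_sum, Finset.sum_sub_distrib, ← Finset.mul_sum, ← Finset.mul_sum,
    Finset.sum_sub_distrib, Complex.div_ofNat_re]
  rfl

/-- Integrating norms over x leaves a product of `baxterFactor` with exponent Re s / 2, not Re (s +
1) / 2. The inequality Re b_j < Re s is what makes it integrable against the eigenfunction. -/
theorem integrable_gaussChain_mul_todaPsi {m : ℕ} (s : ℂ) (b : Fin m → ℂ)
    (hb : ∀ j, (b j).re < s.re) (L : Fin (m + 1) → ℝ) :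
    Integrable (fun p : (Fin m → ℝ) × (Fin m → ℝ) =>
      Complex.exp (s / 2 * ((∑ j : Fin m, L j.castSucc - ∑ j, p.2 j : ℝ) : ℂ)) *
        gaussChain L p.2 p.1 * todaPsi m b p.2) (volume.prod volume) := by
  obtain ⟨β, N, hβ, hN, h1, h2⟩ := exists_expBound_exponents b (σ := s.re / 2)
    fun j => by linarith [hb j]
  obtain ⟨C, hC, hCb⟩ := norm_todaPsi_le m b h1 h2
  have hm : StronglyMeasurable (fun p : (Fin m → ℝ) × (Fin m → ℝ) =>
      Complex.exp (s / 2 * ((∑ j : Fin m, L j.castSucc - ∑ j, p.2 j : ℝ) : ℂ)) *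
        gaussChain L p.2 p.1 * todaPsi m b p.2) := by
    refine StronglyMeasurable.mul (StronglyMeasurable.mul ?_
      (measurable_gaussChain L).stronglyMeasurable)
      ((stronglyMeasurable_todaPsi m b).comp_measurable measurable_snd)
    exact Continuous.stronglyMeasurable (by fun_prop)
  refine (integrable_prod_iff' hm.aestronglyMeasurable).2
    ⟨Filter.Eventually.of_forall fun z => ?_, ?_⟩
  · dsimp only
    exact ((gaussChain_integral L z).1.const_mul _).mul_const _
  · have hm' : StronglyMeasurable fun z => ∫ x, ‖Complex.exp (s / 2 *
        ((∑ j : Fin m, L j.castSucc - ∑ j, z j : ℝ) : ℂ)) * gaussChain L z x * todaPsi m b z‖ :=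
      (hm.comp_measurable measurable_swap).norm.integral_prod_right'
    refine ((integrable_prod_baxterFactor_mul_expBound hβ hN
      (fun j : Fin m => L j.castSucc)).const_mul C).mono' hm'.aestronglyMeasurable
      (Filter.Eventually.of_forall fun z => ?_)
    rw [Real.norm_eq_abs, abs_of_nonneg (integral_nonneg fun _ => norm_nonneg _)]
    simp_rw [norm_mul]
    rw [integral_mul_const, integral_const_mul]
    calc _ ≤ ‖Complex.exp (s / 2 * ((∑ j : Fin m, L j.castSucc - ∑ j, z j : ℝ) : ℂ))‖ *
          Real.exp (-(Real.pi * ∑ j : Fin m, Real.exp (L j.castSucc - z j))) *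
          (C * ∏ j, expBound β N (z j)) := by
          gcongr
          · exact (gaussChain_integral L z).2.2
          · exact hCb z
      _ = _ := by
          rw [norm_exp_mul_prod_baxterFactor s (fun j : Fin m => L j.castSucc)]
          ring

/-- The Jacquet-type recursion for Toda eigenfunctions, in logarithmic coordinates. -/
theorem todaPsi_succ_eq_integral_jacquetWeight {m : ℕ} (a : Fin (m + 1) → ℂ)
    (ha : ∀ j : Fin m, (a j.succ).re < (a 0).re) (L : Fin (m + 1) → ℝ) :
    Integrable (fun x => todaPsi m (fun j => a j.succ) (logShift L x) * jacquetWeight (a 0) L x) ∧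
    todaPsi (m + 1) a L = (∏ j : Fin m, Complex.Gammaℝ (a 0 - a j.succ + 1)) *
      Complex.exp (a 0 / 2 * (L (Fin.last m) : ℝ)) *
      ∫ x, todaPsi m (fun j => a j.succ) (logShift L x) * jacquetWeight (a 0) L x := by
  set b : Fin m → ℂ := fun j => a j.succ with hb
  set Γ := ∏ j : Fin m, Complex.Gammaℝ (a 0 - a j.succ + 1) with hΓ
  -- Needed to recover integrability of the x-integrand itself, as Fubini yields it only multiplied
  -- by Γ.
  have hΓ0 : Γ ≠ 0 := Finset.prod_ne_zero_iff.2 fun j _ => by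
    refine Complex.Gammaℝ_ne_zero_of_re_pos ?_
    simp only [Complex.add_re, Complex.sub_re, Complex.one_re]
    linarith [ha j]
  have hI := integrable_gaussChain_mul_todaPsi (a 0) b ha L
  have hx : ∀ x, ∫ z, Complex.exp (a 0 / 2 * ((∑ j : Fin m, L j.castSucc - ∑ j, z j : ℝ) : ℂ)) *
      gaussChain L z x * todaPsi m b z =
      Γ * (todaPsi m b (logShift L x) * jacquetWeight (a 0) L x) := by
    intro x
    -- The eigenvalue equation at the shifted point, with spectral parameter a₁ + 1.
    have h := integral_baxterKer_mul_todaPsi m b (a 0 + 1) (fun j => by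
      simp only [Complex.add_re, Complex.one_re]
      linarith [ha j]) (logShift L x)
    have e : ∏ j, Complex.Gammaℝ (a 0 + 1 - b j) = Γ :=
      Finset.prod_congr rfl fun j _ => by rw [hb]; congr 1; ring
    rw [e] at h
    rw [← mul_assoc, ← h, ← integral_mul_const]
    congr 1
    ext z
    rw [← baxterKer_logShift, jacquetWeight]
    ring
  have hΦ : Integrable fun x => Γ * (todaPsi m b (logShift L x) * jacquetWeight (a 0) L x) := by
    simp_rw [← hx]
    exact hI.integral_prod_left
  refine ⟨(integrable_const_mul_iff (IsUnit.mk0 _ hΓ0) _).1 hΦ, ?_⟩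
  rw [mul_right_comm, ← integral_const_mul]
  simp_rw [← hx]
  rw [integral_integral_swap hI, ← integral_mul_const]
  change ∫ z, todaKer (a 0) L z * todaPsi m b z = _
  congr 1
  ext z
  rw [integral_mul_const, integral_const_mul, (gaussChain_integral L z).2.1, todaKer_eq,
    Complex.ofReal_exp, ← Complex.exp_add, mul_right_comm, ← Complex.exp_add,
    Fin.sum_univ_castSucc L]
  congr 2
  simp only [sub_eq_add_neg, Real.exp_add, Finset.sum_add_distrib]
  have : ∑ j : Fin m, Real.exp (-L j.succ) * Real.exp (z j) =
      ∑ j : Fin m, Real.exp (z j) * Real.exp (-L j.succ) :=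
    Finset.sum_congr rfl fun _ _ => mul_comm _ _
  rw [this]
  push_cast
  ring

/-! ### Translation and twisting -/

/-- The twist of the kernel is exp (b/2 (∑ x - ∑ u)); the inductive factor cancels its u part. -/
theorem todaPsi_twist (n : ℕ) (a : Fin n → ℂ) (b : ℂ) (x : Fin n → ℝ) :
    todaPsi n (fun j => a j + b) x =
      Complex.exp (b / 2 * ((∑ j, x j : ℝ) : ℂ)) * todaPsi n a x := by
  induction n with
  | zero => simp [todaPsi]
  | succ n ih =>
    rw [todaPsi, todaPsi, ← integral_const_mul]
    congr 1
    ext u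
    rw [ih (fun j => a j.succ), todaKer_eq, todaKer_eq, ← mul_assoc, ← mul_assoc,
      ← Complex.exp_add, ← Complex.exp_add]
    congr 2
    rw [Complex.ofReal_sub]
    ring

/-- Translating x and u together fixes the exponentials of differences; x has one coordinate more
than u, so each rank contributes exp (c a₁ / 2) for its own first parameter. -/
theorem todaPsi_add_const (n : ℕ) (a : Fin n → ℂ) (c : ℝ) (x : Fin n → ℝ) :
    todaPsi n a (fun j => x j + c) =
      Complex.exp ((c : ℂ) / 2 * ∑ j, a j) * todaPsi n a x := by
  induction n with
  | zero => simp [todaPsi]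
  | succ n ih =>
    rw [todaPsi, todaPsi, ← integral_const_mul,
      ← integral_add_right_eq_self _ (fun _ : Fin n => c)]
    congr 1
    ext u
    have hu : (u + fun _ : Fin n => c) = fun j => u j + c := rfl
    rw [hu, ih (fun j => a j.succ), todaKer_eq, todaKer_eq, mul_left_comm, ← mul_assoc,
      ← mul_assoc, ← Complex.exp_add, ← Complex.exp_add]
    congr 2
    simp only [← Real.exp_add, Fin.sum_univ_succ a]
    have e1 : ∀ p q : ℝ, p + c + -(q + c) = p + -q := fun p q => by ring
    have e2 : ∀ p q : ℝ, -(p + c) + (q + c) = -p + q := fun p q => by ring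
    simp only [e1, e2, Finset.sum_add_distrib, Finset.sum_const, Finset.card_univ,
      Fintype.card_fin, nsmul_eq_mul]
    push_cast
    ring

/-! ### Logarithmic change of variables -/

theorem setIntegral_pos_eq_integral_exp {m : ℕ} (F : (Fin m → ℝ) → ℂ) :
    ∫ t in {t : Fin m → ℝ | ∀ j, 0 < t j}, F t * ∏ j, ((1 / t j : ℝ) : ℂ) =
      ∫ w : Fin m → ℝ, F (fun j => Real.exp (w j)) := by
  set E : (Fin m → ℝ) → (Fin m → ℝ) := fun w j => Real.exp (w j) with hE
  have himg : E '' Set.univ = {t : Fin m → ℝ | ∀ j, 0 < t j} := by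
    ext t
    simp only [Set.image_univ, Set.mem_range, Set.mem_ofPred_eq, hE]
    constructor
    · rintro ⟨w, rfl⟩ j
      exact Real.exp_pos _
    · intro h
      exact ⟨fun j => Real.log (t j), funext fun j => Real.exp_log (h j)⟩
  have hinj : Function.Injective E := fun w w' h =>
    funext fun j => Real.exp_injective (congrFun h j)
  have hder : ∀ w ∈ Set.univ, HasFDerivWithinAt E (ContinuousLinearMap.pi fun j : Fin m =>
      (Real.exp (w j) • ContinuousLinearMap.id ℝ ℝ).comp
        (ContinuousLinearMap.proj (R := ℝ) (φ := fun _ : Fin m => ℝ) j)) Set.univ w := by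
    intro w _
    rw [hasFDerivWithinAt_univ, hasFDerivAt_pi]
    intro j
    have h := (Real.hasDerivAt_exp (w j)).hasFDerivAt.comp w
      (ContinuousLinearMap.proj (R := ℝ) (φ := fun _ : Fin m => ℝ) j).hasFDerivAt
    convert h using 1
    congr 1
    ext
    simp [mul_comm]
  rw [← himg, integral_image_eq_integral_abs_det_fderiv_smul volume MeasurableSet.univ hder
    hinj.injOn, Measure.restrict_univ]
  congr 1
  ext w
  rw [ContinuousLinearMap.det_pi]
  have : ∀ j, (Real.exp (w j) • ContinuousLinearMap.id ℝ ℝ).det = Real.exp (w j) := fun j => by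
    simp [ContinuousLinearMap.det]
  simp_rw [this]
  rw [abs_of_pos (Finset.prod_pos fun j _ => Real.exp_pos _), Complex.real_smul,
    mul_left_comm, Complex.ofReal_prod, ← Finset.prod_mul_distrib]
  rw [Finset.prod_eq_one, mul_one]
  intro j _
  rw [← Complex.ofReal_mul, mul_one_div_cancel (Real.exp_pos _).ne', Complex.ofReal_one]

theorem cpow_eq_exp_mul_log {r : ℝ} (hr : 0 < r) (s : ℂ) :
    (r : ℂ) ^ s = Complex.exp (s * (Real.log r : ℝ)) := by
  rw [Complex.cpow_def_of_ne_zero (by exact_mod_cast hr.ne'), ← Complex.ofReal_log hr.le,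
    mul_comm]

/-! ### Logarithmic coordinates of the torus -/

/-- The logarithms of the squares of the diagonal entries of `α[y_1, …, y_n]`. -/
noncomputable def logCoord {n : ℕ} (y : Fin n → ℝ) (j : Fin n) : ℝ :=
  2 * ∑ i ∈ Finset.Ici j, Real.log (y i)

theorem logCoord_last {n : ℕ} (y : Fin (n + 1) → ℝ) :
    logCoord y (Fin.last n) = 2 * Real.log (y (Fin.last n)) := by
  have : Finset.Ici (Fin.last n) = {Fin.last n} := by
    ext i
    simp only [Finset.mem_Ici, Finset.mem_singleton]
    exact Fin.last_le_iff
  rw [logCoord, this, Finset.sum_singleton]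

theorem logCoord_castSucc {n : ℕ} (y : Fin (n + 1) → ℝ) (j : Fin n) :
    logCoord y j.castSucc = 2 * Real.log (y j.castSucc) + logCoord y j.succ := by
  have : Finset.Ici j.castSucc = insert j.castSucc (Finset.Ici j.succ) := by
    ext i
    simp only [Finset.mem_Ici, Finset.mem_insert, Fin.le_def, Fin.ext_iff, Fin.val_castSucc,
      Fin.val_succ]
    omega
  rw [logCoord, logCoord, this, Finset.sum_insert (by simp [Fin.le_def])]
  ring

theorem logCoord_eq_of_forall {n : ℕ} {y f : Fin (n + 1) → ℝ}
    (hl : f (Fin.last n) = 2 * Real.log (y (Fin.last n)))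
    (hs : ∀ j : Fin n, f j.castSucc = 2 * Real.log (y j.castSucc) + f j.succ) :
    logCoord y = f := by
  ext j
  induction j using Fin.reverseInduction with
  | last => rw [hl, logCoord_last]
  | cast j ih => rw [hs, logCoord_castSucc, ih]

/-- Abel summation, for the powers of y_j in the defining recursion. -/
theorem sum_sub_mul_sub_eq (m : ℕ) (f : Fin (m + 1) → ℝ) :
    ∑ j : Fin m, ((m : ℝ) - j) * (f j.castSucc - f j.succ) =
      m * f 0 - ∑ j : Fin m, f j.succ := by
  induction m with
  | zero => simp
  | succ m ih =>
    have h := ih fun j => f j.castSucc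
    rw [Fin.sum_univ_castSucc, Fin.sum_univ_castSucc (fun j : Fin (m + 1) => f j.succ)]
    have e : ∑ j : Fin m, (((m + 1 : ℕ) : ℝ) - (j.castSucc : Fin (m + 1))) *
        (f j.castSucc.castSucc - f j.castSucc.succ) =
        ∑ j : Fin m, ((m : ℝ) - j) * (f j.castSucc.castSucc - f j.succ.castSucc) +
          ∑ j : Fin m, (f j.castSucc.castSucc - f j.succ.castSucc) := by
      rw [← Finset.sum_add_distrib]
      refine Finset.sum_congr rfl fun j _ => ?_
      rw [Fin.val_castSucc, Fin.succ_castSucc]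
      push_cast
      ring
    have t : ∑ j : Fin m, (f j.castSucc.castSucc - f j.succ.castSucc) =
        f 0 - f (Fin.last m).castSucc := by
      have := Fin.sum_univ_castSucc fun j : Fin (m + 1) => f j.castSucc
      rw [Fin.sum_univ_succ] at this
      rw [Finset.sum_sub_distrib]
      simp only [Fin.castSucc_zero] at this
      linarith
    rw [e, h, t]
    simp only [Fin.castSucc_zero, Fin.val_last, Fin.succ_last, Fin.succ_castSucc]
    push_cast
    ring

theorem sum_fin_sub_self (m : ℕ) : ∑ j : Fin m, ((m : ℝ) - j) = m * (m + 1) / 2 := by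
  induction m with
  | zero => simp
  | succ m ih =>
    rw [Fin.sum_univ_succ]
    have : ∀ i : Fin m, ((m + 1 : ℕ) : ℝ) - (i.succ : Fin (m + 1)) = (m : ℝ) - i := fun i => by
      rw [Fin.val_succ]; push_cast; ring
    simp_rw [this]
    rw [ih]
    push_cast
    simp
    ring

/-- Abel summation, for the powers of y_j in front of the new integral. -/
theorem sum_succ_mul_sub_eq (m : ℕ) (f : Fin (m + 1) → ℝ) :
    ∑ j : Fin m, ((j : ℝ) + 1) * (f j.castSucc - f j.succ) =
      ∑ j : Fin m, f j.castSucc - m * f (Fin.last m) := by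
  induction m with
  | zero => simp
  | succ m ih =>
    have h := ih fun j => f j.castSucc
    rw [Fin.sum_univ_castSucc, Fin.sum_univ_castSucc (fun j : Fin (m + 1) => f j.castSucc)]
    simp only [Fin.val_castSucc, Fin.succ_castSucc, Fin.val_last, Fin.succ_last] at h ⊢
    rw [h]
    push_cast
    ring

/-! ### Identification with the class one Whittaker function -/

theorem todaPsi_one (a : Fin 1 → ℂ) (x : Fin 1 → ℝ) :
    todaPsi 1 a x = Complex.exp (a 0 / 2 * (x 0 : ℝ)) := by
  simp [todaPsi, todaKer, volume_pi, measureReal_def]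

theorem exp_logCoord_sub {n : ℕ} {y : Fin (n + 1) → ℝ} (hy : ∀ j, 0 < y j) (j : Fin n) :
    Real.exp (logCoord y j.castSucc - logCoord y j.succ) = y j.castSucc ^ 2 := by
  rw [logCoord_castSucc, add_sub_cancel_right, ← Real.log_rpow (hy _),
    Real.exp_log (by have := hy j.castSucc; positivity)]
  norm_num

theorem besselK_eq_integral (ν : ℂ) (r : ℝ) :
    besselK ν r = 1 / 2 * ∫ w : ℝ, Complex.exp (ν * w -
      ((r / 2 * (Real.exp w + Real.exp (-w)) : ℝ) : ℂ)) := by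
  rw [besselK, setIntegral_Ioi_eq_integral_comp_exp]
  congr 2
  ext w
  have h : ((Real.exp w : ℝ) : ℂ) * ((1 / Real.exp w : ℝ) : ℂ) = 1 := by
    rw [← Complex.ofReal_mul, mul_one_div_cancel (Real.exp_pos w).ne', Complex.ofReal_one]
  rw [cpow_eq_exp_mul_log (Real.exp_pos w), Real.log_exp, Complex.real_smul,
    show ∀ A B C D : ℂ, A * (B * C * D) = A * D * (B * C) from fun A B C D => by ring, h, one_mul,
    Complex.ofReal_exp, ← Complex.exp_add, one_div, ← Real.exp_neg]
  congr 1
  push_cast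
  ring

theorem glWhittakerHat_two (a : Fin 2 → ℂ) {y : Fin 2 → ℝ} (hy : ∀ j, 0 < y j) :
    glWhittakerHat 2 a y = todaPsi 2 a (logCoord y) := by
  have h1 : logCoord y 1 = 2 * Real.log (y 1) := logCoord_last y
  have h0 : logCoord y 0 = 2 * Real.log (y 0) + logCoord y 1 := logCoord_castSucc y 0
  have hpsi : todaPsi 2 a (logCoord y) = ∫ t : ℝ,
      Complex.exp (a 0 / 2 * ((logCoord y 0 + logCoord y 1 - t : ℝ) : ℂ) -
        ((Real.pi * (Real.exp (logCoord y 0) * Real.exp (-t) +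
          Real.exp (-logCoord y 1) * Real.exp t) : ℝ) : ℂ)) *
        Complex.exp (a 1 / 2 * t) := by
    rw [todaPsi, ← (volume_preserving_funUnique (Fin 1) ℝ).integral_comp
      (MeasurableEquiv.measurableEmbedding _)]
    congr 1
    ext u
    rw [todaPsi_one, todaKer_eq]
    simp [Fin.sum_univ_two]
  -- The point `logCoord y 1 + Real.log (y 0)` is the midpoint of the two coordinates; centring
  -- there makes both coefficients equal to y₁, as in the Bessel integral.
  rw [hpsi, ← integral_sub_left_eq_self _ volume (logCoord y 1 + Real.log (y 0)), glWhittakerHat,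
    besselK_eq_integral, cpow_eq_exp_mul_log (hy 0), cpow_eq_exp_mul_log (hy 1),
    show ∀ A B C : ℂ, A * (2 * B * (1 / 2 * C)) = A * B * C from fun A B C => by ring,
    ← integral_const_mul]
  congr 1
  ext w
  rw [← Complex.exp_add, ← Complex.exp_add, ← Complex.exp_add]
  congr 1
  have e1 : Real.exp (logCoord y 0) * Real.exp (-(logCoord y 1 + Real.log (y 0) - w)) =
      y 0 * Real.exp w := by
    rw [← Real.exp_add, h0, show 2 * Real.log (y 0) + logCoord y 1 +
      -(logCoord y 1 + Real.log (y 0) - w) = Real.log (y 0) + w by ring, Real.exp_add,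
      Real.exp_log (hy 0)]
  have e2 : Real.exp (-logCoord y 1) * Real.exp (logCoord y 1 + Real.log (y 0) - w) =
      y 0 * Real.exp (-w) := by
    rw [← Real.exp_add, show -logCoord y 1 + (logCoord y 1 + Real.log (y 0) - w) =
      Real.log (y 0) + -w by ring, Real.exp_add, Real.exp_log (hy 0)]
  rw [e1, e2, h0, h1]
  push_cast
  ring

theorem todaPsi_tildeParam {m : ℕ} (a : Fin (m + 1) → ℂ) (x : Fin m → ℝ) :
    todaPsi m (tildeParam a) x = Complex.exp (a 0 / m / 2 * ((∑ j, x j : ℝ) : ℂ)) *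
      todaPsi m (fun j => a j.succ) x :=
  todaPsi_twist m (fun j => a j.succ) (a 0 / m) x

theorem sum_tildeParam {m : ℕ} (hm : m ≠ 0) (a : Fin (m + 1) → ℂ) :
    ∑ j, tildeParam a j = ∑ j, a j := by
  have : (m : ℂ) ≠ 0 := by exact_mod_cast hm
  simp only [tildeParam]
  rw [Finset.sum_add_distrib, Fin.sum_univ_succ a, Finset.sum_const, Finset.card_univ,
    Fintype.card_fin, nsmul_eq_mul, mul_div_cancel₀ _ this, add_comm]

theorem glWhittakerHat_add_three (k : ℕ) (a : Fin (k + 3) → ℂ) {y : Fin (k + 3) → ℝ}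
    (hy : ∀ j, 0 < y j)
    (ih : ∀ (b : Fin (k + 2) → ℂ) {y' : Fin (k + 2) → ℝ}, (∀ j, 0 < y' j) →
      glWhittakerHat (k + 2) b y' = todaPsi (k + 2) b (logCoord y')) :
    glWhittakerHat (k + 3) a y = todaPsi (k + 3) a (logCoord y) := by
  set L := logCoord y with hL
  set l := Real.log (y (Fin.last (k + 2))) with hl
  have hLl : L (Fin.last (k + 2)) = 2 * l := logCoord_last y
  have hpi := Real.pi_pos
  set P : ℝ := Real.log Real.pi with hP
  have hm0 : ((k : ℂ) + 2) ≠ 0 := by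
    have : ((k + 2 : ℕ) : ℂ) ≠ 0 := by exact_mod_cast (by omega : k + 2 ≠ 0)
    simpa using this
  -- the value of the lower rank function after the change of variables
  have hW : ∀ w : Fin (k + 2) → ℝ, glWhittakerHat (k + 2) (tildeParam a)
      (Fin.snoc (α := fun _ => ℝ) (fun i : Fin (k + 1) => y i.succ.castSucc *
        Real.sqrt (Real.exp (w i.succ) / Real.exp (w i.castSucc))) 1) =
      Complex.exp (((w (Fin.last (k + 1)) - 2 * l : ℝ) : ℂ) / 2 * ∑ j, a j) *
        (Complex.exp (a 0 / ((k : ℂ) + 2) / 2 *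
          ((∑ j : Fin (k + 2), (L j.succ - w j) : ℝ) : ℂ)) *
          todaPsi (k + 2) (fun j => a j.succ) (fun j => L j.succ - w j)) := by
    intro w
    rw [ih]
    · have : logCoord (Fin.snoc (α := fun _ => ℝ) (fun i : Fin (k + 1) => y i.succ.castSucc *
          Real.sqrt (Real.exp (w i.succ) / Real.exp (w i.castSucc))) 1) =
          fun j : Fin (k + 2) => (L j.succ - w j) + (w (Fin.last (k + 1)) - 2 * l) := by
        refine logCoord_eq_of_forall ?_ fun j => ?_
        · rw [Fin.snoc_last, Fin.succ_last, hLl]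
          simp
        · rw [Fin.snoc_castSucc, Real.log_mul (hy _).ne' (by positivity), ← Real.exp_sub,
            ← Real.exp_half, Real.log_exp, hL, Fin.succ_castSucc, logCoord_castSucc]
          ring
      rw [this, todaPsi_add_const, sum_tildeParam (by omega), todaPsi_tildeParam]
      push_cast
      rfl
    · intro j
      refine Fin.lastCases ?_ (fun i => ?_) j
      · simp
      · rw [Fin.snoc_castSucc]
        exact mul_pos (hy _) (by positivity)
  -- The substitution is u_j = L_{j+1} - log π - w_j with t_j = exp w_j. It turns the two
  -- exponentials of the Toda kernel into (π y_j)² t_j and 1 / t_j.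
  have hR : todaPsi (k + 3) a L = ∫ w : Fin (k + 2) → ℝ,
      todaKer (a 0) L ((fun j : Fin (k + 2) => L j.succ + -P) - w) *
        todaPsi (k + 2) (fun j => a j.succ) ((fun j : Fin (k + 2) => L j.succ + -P) - w) := by
    rw [todaPsi, ← integral_sub_left_eq_self _ volume (fun j : Fin (k + 2) => L j.succ + -P)]
  rw [glWhittakerHat, setIntegral_pos_eq_integral_exp, hR, ← integral_const_mul]
  congr 1
  ext w
  rw [hW w]
  have hz : (fun j : Fin (k + 2) => L j.succ + -P) - w = fun j => (L j.succ - w j) + -P := by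
    ext j
    simp only [Pi.sub_apply]
    ring
  rw [hz, todaPsi_add_const, todaKer_eq]
  -- the product of exponentials
  have hfac : ∀ j : Fin (k + 2),
      (Real.exp (-(Real.pi * y j.castSucc) ^ 2 * Real.exp (w j) - 1 / Real.exp (w j)) : ℂ) *
        ((Real.pi * y j.castSucc : ℝ) : ℂ) ^
          ((((k : ℂ) + 2) - (j : ℕ)) * a 0 / ((k : ℂ) + 2)) *
        (Real.exp (w j) : ℂ) ^ (((k : ℂ) + 3) * a 0 / (2 * ((k : ℂ) + 2))) =
      Complex.exp (((-(Real.pi * (Real.exp (L j.castSucc) * Real.exp (-(L j.succ - w j + -P)) +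
          Real.exp (-L j.succ) * Real.exp (L j.succ - w j + -P))) : ℝ) : ℂ) +
        a 0 / ((k : ℂ) + 2) * (((((k + 2 : ℕ) : ℝ) - j) * P : ℝ) : ℂ) +
        a 0 / (2 * ((k : ℂ) + 2)) * (((((k + 2 : ℕ) : ℝ) - j) *
          (L j.castSucc - L j.succ) : ℝ) : ℂ) +
        ((k : ℂ) + 3) * a 0 / (2 * ((k : ℂ) + 2)) * (w j : ℝ)) := by
    intro j
    have e1 : Real.exp (L j.castSucc) * Real.exp (-(L j.succ - w j + -P)) =
        Real.pi * y j.castSucc ^ 2 * Real.exp (w j) := by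
      rw [← Real.exp_add, show L j.castSucc + -(L j.succ - w j + -P) =
        P + (L j.castSucc - L j.succ) + w j by ring, Real.exp_add, Real.exp_add,
        hL, exp_logCoord_sub hy, hP, Real.exp_log hpi]
    have e2 : Real.exp (-L j.succ) * Real.exp (L j.succ - w j + -P) =
        1 / (Real.pi * Real.exp (w j)) := by
      rw [← Real.exp_add, show -L j.succ + (L j.succ - w j + -P) = -(P + w j) by ring,
        Real.exp_neg, Real.exp_add, hP, Real.exp_log hpi, one_div]
    have e3 : L j.castSucc - L j.succ = 2 * Real.log (y j.castSucc) := by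
      rw [hL, logCoord_castSucc]
      ring
    rw [e1, e2, e3, cpow_eq_exp_mul_log (mul_pos hpi (hy _)), cpow_eq_exp_mul_log
      (Real.exp_pos _), Real.log_exp, Real.log_mul hpi.ne' (hy _).ne', ← hP, Complex.ofReal_exp,
      ← Complex.exp_add, ← Complex.exp_add]
    congr 1
    have e4 : -(Real.pi * (Real.pi * y j.castSucc ^ 2 * Real.exp (w j) +
        1 / (Real.pi * Real.exp (w j)))) =
        -(Real.pi * y j.castSucc) ^ 2 * Real.exp (w j) - 1 / Real.exp (w j) := by
      have := Real.exp_pos (w j)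
      field_simp
      ring
    rw [e4]
    push_cast
    field_simp
    ring
  rw [Finset.prod_congr rfl fun j _ => hfac j, ← Complex.exp_sum,
    cpow_eq_exp_mul_log (hy _), cpow_eq_exp_mul_log (mul_pos hpi (Real.exp_pos _)),
    Real.log_mul hpi.ne' (Real.exp_pos _).ne', Real.log_exp, ← hl, ← hP]
  rw [show ∀ A B C D E T : ℂ, A * (B * (C * T) * D * E) = (A * B * C * D * E) * T from
    fun A B C D E T => by ring, ← mul_assoc, ← Complex.exp_add, ← Complex.exp_add,
    ← Complex.exp_add, ← Complex.exp_add, ← Complex.exp_add]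
  congr 2
  have s1 := sum_sub_mul_sub_eq (k + 2) L
  have s2 := sum_fin_sub_self (k + 2)
  rw [Finset.sum_add_distrib, Finset.sum_add_distrib, Finset.sum_add_distrib, ← Finset.mul_sum,
    ← Finset.mul_sum, ← Finset.mul_sum, ← Complex.ofReal_sum, ← Complex.ofReal_sum,
    ← Complex.ofReal_sum, ← Complex.ofReal_sum, s1, ← Finset.sum_mul, s2,
    Finset.sum_neg_distrib, ← Finset.mul_sum, Finset.sum_add_distrib]
  rw [Fin.sum_univ_succ a, Fin.sum_univ_succ L]
  simp only [Finset.sum_add_distrib, Finset.sum_sub_distrib, Finset.sum_const, Finset.card_univ,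
    Fintype.card_fin, nsmul_eq_mul]
  generalize ∑ j : Fin (k + 2), L j.succ = SL
  generalize ∑ j : Fin (k + 2), w j = Sw
  generalize ∑ j : Fin (k + 2), a j.succ = Sa
  push_cast
  field_simp
  ring

theorem glWhittakerHat_eq_todaPsi (n : ℕ) (a : Fin (n + 1) → ℂ) {y : Fin (n + 1) → ℝ}
    (hy : ∀ j, 0 < y j) : glWhittakerHat (n + 1) a y = todaPsi (n + 1) a (logCoord y) := by
  induction n with
  | zero =>
    rw [glWhittakerHat, todaPsi_one, cpow_eq_exp_mul_log (hy 0)]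
    have : logCoord y 0 = 2 * Real.log (y 0) := logCoord_last y
    rw [this]
    congr 1
    push_cast
    ring
  | succ n ih =>
    cases n with
    | zero => exact glWhittakerHat_two a hy
    | succ k => exact glWhittakerHat_add_three k a hy ih

/-- The prefactor collects what does not depend on x: the twist by a₁ / (n - 1) and the translation
by the last coordinate of L. The twist also supplies the part of the power of q_1 that exceeds the
weight's exponent -a₁ / 2. -/
theorem glRecIntegrand_eq {m : ℕ} (hm : 1 ≤ m) (a : Fin (m + 1) → ℂ) {y : Fin (m + 1) → ℝ}
    (hy : ∀ j, 0 < y j) (x : Fin m → ℝ) :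
    glRecIntegrand a y x = Complex.exp (a 0 / (2 * m) * ((∑ j : Fin m, logCoord y j.castSucc -
        m * logCoord y (Fin.last m) : ℝ) : ℂ) -
        (logCoord y (Fin.last m) : ℝ) / 2 * ∑ j : Fin m, a j.succ) *
      (todaPsi m (fun j => a j.succ) (logShift (logCoord y) x) *
        jacquetWeight (a 0) (logCoord y) x) := by
  obtain ⟨k, rfl⟩ : ∃ k, m = k + 1 := ⟨m - 1, by omega⟩
  set L := logCoord y with hL
  have hm0 : (((k + 1 : ℕ) : ℂ)) ≠ 0 := by exact_mod_cast (by omega : k + 1 ≠ 0)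
  have hlog : ∀ j : Fin (k + 1), Real.log (y j.castSucc * (Real.sqrt (qSum x (j : ℕ) *
      qSum x ((j : ℕ) + 2)) / qSum x ((j : ℕ) + 1))) = (L j.castSucc - L j.succ) / 2 +
      (Real.log (qSum x j) + Real.log (qSum x (j + 2))) / 2 - Real.log (qSum x (j + 1)) := by
    intro j
    have h0 := qSum_pos x j
    have h1 := qSum_pos x (j + 1)
    have h2 := qSum_pos x (j + 2)
    rw [Real.log_mul (hy _).ne' (by positivity), Real.log_div (by positivity) h1.ne',
      Real.log_sqrt (by positivity), Real.log_mul h0.ne' h2.ne', hL, logCoord_castSucc]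
    ring
  have hW : glWhittakerHat (k + 1) (tildeParam a) (fun j => y j.castSucc *
      (Real.sqrt (qSum x (j : ℕ) * qSum x ((j : ℕ) + 2)) / qSum x ((j : ℕ) + 1))) =
      todaPsi (k + 1) (tildeParam a)
        (fun j => logShift L x j + -L (Fin.last (k + 1))) := by
    rw [glWhittakerHat_eq_todaPsi]
    · congr 1
      -- Successive differences of `logShift` carry q_j q_{j+2} / q_{j+1}²; at the end q_n = q_{n+1}
      -- = 1.
      refine logCoord_eq_of_forall ?_ fun j => ?_
      · rw [hlog, logShift, Fin.val_last, Fin.succ_last, qSum_of_le x (by omega : k + 1 ≤ k + 1),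
          qSum_of_le x (by omega : k + 1 ≤ k + 2), Real.log_one]
        ring
      · rw [hlog, logShift, logShift, Fin.val_castSucc, Fin.val_succ, Fin.succ_castSucc]
        ring
    · intro j
      have h0 := qSum_pos x j
      have h1 := qSum_pos x (j + 1)
      have h2 := qSum_pos x (j + 2)
      exact mul_pos (hy _) (by positivity)
  have hX : ∑ j, logShift L x j = ∑ j : Fin (k + 1), L j.castSucc + Real.log (qSum x 0) := by
    rw [← sum_log_qSum_sub x, ← Finset.sum_add_distrib]
    exact Finset.sum_congr rfl fun j _ => by rw [logShift]; ring
  have hy' : ∀ j : Fin (k + 1), Real.exp ((L j.castSucc - L j.succ) / 2) = y j.castSucc := by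
    intro j
    rw [hL, logCoord_castSucc, add_sub_cancel_right, mul_div_cancel_left₀ _ two_ne_zero,
      Real.exp_log (hy _)]
  rw [glRecIntegrand, hW, todaPsi_add_const, sum_tildeParam (by omega), todaPsi_tildeParam,
    jacquetWeight, cpow_eq_exp_mul_log (qSum_pos x 0), hX]
  simp_rw [hy']
  rw [show ∀ A B T F Q R : ℂ, A * (B * T) * F * Q * R = (A * B * Q) * (T * (F * R)) from
    fun A B T F Q R => by ring, show ∀ A T F Q R : ℂ, A * (T * (F * Q * R)) =
    (A * Q) * (T * (F * R)) from fun A T F Q R => by ring, ← Complex.exp_add, ← Complex.exp_add,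
    ← Complex.exp_add]
  congr 2
  rw [Fin.sum_univ_succ a]
  push_cast at hm0 ⊢
  field_simp
  ring

/-- Here `n = m + 1 ≥ 2`. -/
theorem proposition1p3 (m : ℕ) (hm : 1 ≤ m) (a : Fin (m + 1) → ℂ)
    (ha : ∀ j : Fin m, (a j.succ).re < (a 0).re)
    (y : Fin (m + 1) → ℝ) (hy : ∀ j, 0 < y j) :
    Integrable (glRecIntegrand a y) ∧
    glWhittakerHat (m + 1) a y =
      (∏ j : Fin m, Complex.Gammaℝ (a 0 - a j.succ + 1)) *
        (y (Fin.last m) : ℂ) ^ (∑ i, a i) *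
        (∏ j : Fin m, (y j.castSucc : ℂ) ^ (-((((j : ℕ) : ℂ) + 1) * a 0 / (m : ℂ)))) *
        ∫ x : Fin m → ℝ, glRecIntegrand a y x := by
  have hm0 : (m : ℂ) ≠ 0 := by exact_mod_cast (by omega : m ≠ 0)
  obtain ⟨hI, hE⟩ := todaPsi_succ_eq_integral_jacquetWeight a ha (logCoord y)
  have heq := funext (glRecIntegrand_eq hm a hy)
  refine ⟨heq ▸ hI.const_mul _, ?_⟩
  rw [glWhittakerHat_eq_todaPsi m a hy, hE, heq, integral_const_mul]
  have hl := logCoord_last y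
  -- These powers of y cancel the twist in the prefactor of `glRecIntegrand_eq`.
  have hprod : ∏ j : Fin m, (y j.castSucc : ℂ) ^ (-((((j : ℕ) : ℂ) + 1) * a 0 / (m : ℂ))) =
      Complex.exp (-(a 0 / (2 * m)) * ((∑ j : Fin m, logCoord y j.castSucc -
        m * logCoord y (Fin.last m) : ℝ) : ℂ)) := by
    rw [← sum_succ_mul_sub_eq, Complex.ofReal_sum, Finset.mul_sum, Complex.exp_sum]
    refine Finset.prod_congr rfl fun j _ => ?_
    rw [cpow_eq_exp_mul_log (hy _), logCoord_castSucc, add_sub_cancel_right]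
    congr 1
    push_cast
    field_simp
  rw [hprod, cpow_eq_exp_mul_log (hy _), show ∀ G A B C I : ℂ, G * A * B * (C * I) =
    G * (A * B * C) * I from fun G A B C I => by ring, ← Complex.exp_add, ← Complex.exp_add]
  congr 3
  rw [hl, Fin.sum_univ_succ a]
  push_cast
  ring
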